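/- Consider a continuous-time Markov decision process with countable state space $S$, finite action space $A$, nonempty action sets $A(i)\subseteq A$, transition rates $q(j|i,a)\ge 0$ for $j\ne i$ with $\sum_{j\in S}q(j|i,a)=0$ for $i\in S$, $a\in A(i)$ (the rates may be unbounded in $i$), and cost rates $c(i,a)\in[0,\infty)$ (possibly unbounded). A policy is a randomized Markov policy $\pi=(\pi_t)_{t\ge 0}$: for each $i\in S$ and $t\ge 0$, $\pi_t(\cdot|i)$ is a probability distribution on $A(i)$, measurable in $t$; let $\Pi$ be the set of all policies. Under $\pi$ the state $x(t)$ is the (minimal) Markov jump process with rates $q(j|i,\pi_t)=\sum_a q(j|i,a)\pi_t(a|i)$, the cost rate is $c(i,\pi_t)=\sum_a c(i,a)\pi_t(a|i)$, and no cost is incurred after an explosion, if one occurs. For $\alpha>0$ put $$J_\alpha(i,\pi)=\int_0^\infty e^{-\alpha t}E_i^\pi[c(x(t),\pi_t)]\,dt,\qquad J^*_\alpha(i)=\inf_{\pi\in\Pi}J_\alpha(i,\pi)\in[0,\infty].$$ For states $i,i_0$, the first passage time $\tau$ from $i$ to $i_0$ is the first time at which the process started in $i$ is in $i_0$ and has made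 at least one transition ($\tau=\infty$ if there is no such time); let $m_{i,i_0}(\pi)=E_i^\pi[\tau]$ and $c_{i,i_0}(\pi)=E_i^\pi\big[\int_0^\tau c(x(t),\pi_t)\,dt\big]$ be the expected time and the expected cost of a first passage. Fix $i_0\in S$. (a) Let $\alpha>0$ with $J^*_\alpha(i_0)<\infty$, let $i\ne i_0$, and let $\theta_i$ be a policy with $m_{i,i_0}(\theta_i)<\infty$ and $c_{i,i_0}(\theta_i)<\infty$. Then $J^*_\alpha(i)<\infty$ and $$h_\alpha(i):=J^*_\alpha(i)-J^*_\alpha(i_0)\le c_{i,i_0}(\theta_i).$$ (b) Consequently, suppose that such a policy $\theta_i$ exists for every $i\ne i_0$, and let $H(i)=c_{i,i_0}(\theta_i)$ for $i\neq i_0$ and $H(i_0)$ be any nonnegative real number (for instance $0$). Then assumption (A2) holds for $i_0$ with this $H$ along every decreasing sequence $\alpha_n>0$ tending to $0$ with $J^*_{\alpha_n}(i_0)<\infty$ for all $n$; that is, $H$ is finite and nonnegative, $J^*_{\alpha_n}(i)<\infty$, and $h_{\alpha_n}(i)\le H(i)$ for all $i\in S$ and all $n$. -/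

import Mathlib

open MeasureTheory ProbabilityTheory Filter Topology
open scoped ENNReal

/-- A continuous-time Markov decision process with countable state space `S`, finite action space
`A`, nonempty sets `actions i` of admissible actions, conservative transition rates
`rate i a j` (the rate `q(j | i, a)`) and nonnegative cost rates `cost i a`. -/
structure CTMDP (S A : Type*) where
  actions : S → Finset A
  actions_nonempty : ∀ i, (actions i).Nonempty
  rate : S → A → S → ℝ
  rate_nonneg : ∀ i, ∀ a ∈ actions i, ∀ j, j ≠ i → 0 ≤ rate i a j
  rate_hasSum : ∀ i, ∀ a ∈ actions i, HasSum (rate i a) 0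
  cost : S → A → ℝ
  cost_nonneg : ∀ i, ∀ a ∈ actions i, 0 ≤ cost i a

namespace CTMDP

variable {S A : Type*}

/-- A randomized Markov policy: `prob t i a` is the probability `π_t(a | i)` of using the action
`a` in state `i` at time `t`. Only the values at times `t ≥ 0` and at `a ∈ M.actions i` matter. -/
structure Policy (M : CTMDP S A) where
  prob : ℝ → S → A → ℝ
  prob_measurable : ∀ i a, Measurable fun t => prob t i a
  prob_nonneg : ∀ t i, ∀ a ∈ M.actions i, 0 ≤ prob t i a
  prob_sum : ∀ t i, ∑ a ∈ M.actions i, prob t i a = 1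

variable {M : CTMDP S A}

namespace Policy

/-- The transition rate `q(j | i, π_t) = ∑ a, q(j | i, a) π_t(a | i)`. -/
noncomputable def rate (π : M.Policy) (t : ℝ) (i j : S) : ℝ :=
  ∑ a ∈ M.actions i, M.rate i a j * π.prob t i a

/-- The total rate `-q(i | i, π_t)` of leaving the state `i` at time `t`. -/
noncomputable def exitRate (π : M.Policy) (t : ℝ) (i : S) : ℝ := -π.rate t i i

/-- The expected cost rate `c(i, π_t) = ∑ a, c(i, a) π_t(a | i)`. -/
noncomputable def costRate (π : M.Policy) (t : ℝ) (i : S) : ℝ :=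
  ∑ a ∈ M.actions i, M.cost i a * π.prob t i a

open Classical in
/-- Given that the state `x.2` was entered at time `x.1`, the density (with respect to Lebesgue
measure in the time and counting measure in the state) of the pair formed by the time `t = y.1` of
the next jump and the state `j = y.2` entered there:
`q(j | i, π_t) exp (-∫_s^t q_i(π_u) du)` for `t > s` and `j ≠ i`. -/
noncomputable def jumpDensity (π : M.Policy) (x : ℝ≥0∞ × S) (y : ℝ × S) : ℝ≥0∞ :=
  if x.1 < ENNReal.ofReal y.1 ∧ y.2 ≠ x.2 then
    ENNReal.ofReal (π.rate y.1 x.2 y.2 * Real.exp (-∫ u in x.1.toReal..y.1, π.exitRate u x.2))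
  else 0

lemma measurable_rate (π : M.Policy) (i j : S) : Measurable fun t => π.rate t i j :=
  Finset.measurable_sum _ fun a _ => (π.prob_measurable i a).const_mul _

lemma measurable_exitRate (π : M.Policy) (i : S) : Measurable fun t => π.exitRate t i :=
  (π.measurable_rate i i).neg

lemma prob_le_one (π : M.Policy) (t : ℝ) (i : S) {a : A} (ha : a ∈ M.actions i) :
    π.prob t i a ≤ 1 := by
  rw [← π.prob_sum t i]
  exact Finset.single_le_sum (fun b hb => π.prob_nonneg t i b hb) ha

lemma rate_nonneg (π : M.Policy) (t : ℝ) {i j : S} (h : j ≠ i) : 0 ≤ π.rate t i j :=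
  Finset.sum_nonneg fun a ha => mul_nonneg (M.rate_nonneg i a ha j h) (π.prob_nonneg t i a ha)

lemma rate_hasSum (π : M.Policy) (t : ℝ) (i : S) : HasSum (fun j => π.rate t i j) 0 := by
  have := hasSum_sum (s := M.actions i) (f := fun a j => M.rate i a j * π.prob t i a)
    (a := fun a => 0 * π.prob t i a) fun a ha => (M.rate_hasSum i a ha).mul_right _
  simpa [rate] using this

lemma exists_exitRate_bound (π : M.Policy) (i : S) : ∃ C, ∀ t, ‖π.exitRate t i‖ ≤ C := by
  refine ⟨∑ a ∈ M.actions i, ‖M.rate i a i‖, fun t => ?_⟩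
  rw [exitRate, norm_neg, rate]
  refine (norm_sum_le _ _).trans (Finset.sum_le_sum fun a ha => ?_)
  rw [norm_mul]
  refine mul_le_of_le_one_right (norm_nonneg _) ?_
  rw [Real.norm_of_nonneg (π.prob_nonneg t i a ha)]
  exact π.prob_le_one t i ha

lemma exitRate_nonneg (π : M.Policy) (t : ℝ) (i : S) : 0 ≤ π.exitRate t i := by
  classical
  have h := (π.rate_hasSum t i).update i 0
  simp only [zero_sub, add_zero] at h
  refine h.nonneg fun j => ?_
  by_cases hj : j = i
  · subst hj; simp
  · rw [Function.update_of_ne hj]; exact π.rate_nonneg t hj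

open Classical in
lemma tsum_rate (π : M.Policy) (t : ℝ) (i : S) :
    ∑' j, (if j ≠ i then ENNReal.ofReal (π.rate t i j) else 0)
      = ENNReal.ofReal (π.exitRate t i) := by
  have h := (π.rate_hasSum t i).update i 0
  simp only [zero_sub, add_zero] at h
  have hn : ∀ j, 0 ≤ Function.update (fun j => π.rate t i j) i 0 j := fun j => by
    by_cases hj : j = i
    · subst hj; simp
    · rw [Function.update_of_ne hj]; exact π.rate_nonneg t hj
  rw [exitRate, ← h.tsum_eq, ENNReal.ofReal_tsum_of_nonneg hn h.summable]
  refine tsum_congr fun j => ?_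
  by_cases hj : j = i
  · subst hj; simp
  · simp [hj]

lemma intervalIntegrable_exitRate (π : M.Policy) (i : S) (a b : ℝ) :
    IntervalIntegrable (fun t => π.exitRate t i) volume a b := by
  obtain ⟨C, hC⟩ := π.exists_exitRate_bound i
  refine IntervalIntegrable.mono_fun (g := fun t => π.exitRate t i) (f := fun _ : ℝ => C)
    intervalIntegrable_const (π.measurable_exitRate i).aestronglyMeasurable ?_
  exact ae_of_all _ fun t => (hC t).trans (le_abs_self C)

lemma intervalIntegral_exitRate (π : M.Policy) (i : S) (s t : ℝ) :
    ∫ u in s..t, π.exitRate u i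
      = (∫ u in (0 : ℝ)..t, π.exitRate u i) - ∫ u in (0 : ℝ)..s, π.exitRate u i :=
  (intervalIntegral.integral_interval_sub_left (π.intervalIntegrable_exitRate i 0 t)
    (π.intervalIntegrable_exitRate i 0 s)).symm

lemma continuous_intervalIntegral_exitRate (π : M.Policy) (i : S) :
    Continuous fun t => ∫ u in (0 : ℝ)..t, π.exitRate u i :=
  intervalIntegral.continuous_primitive (fun a b => π.intervalIntegrable_exitRate i a b) 0

lemma measurable_jumpDensity [Countable S] [MeasurableSpace S] [MeasurableSingletonClass S]
    (π : M.Policy) : Measurable fun p : (ℝ≥0∞ × S) × (ℝ × S) => π.jumpDensity p.1 p.2 := by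
  classical
  have key : ∀ i j : S, Measurable fun p : ℝ≥0∞ × ℝ => π.jumpDensity (p.1, i) (p.2, j) := by
    intro i j
    unfold jumpDensity
    refine Measurable.ite ?_ ?_ measurable_const
    · by_cases h : j = i
      · simp [h]
      · have := measurableSet_lt (measurable_fst (α := ℝ≥0∞) (β := ℝ))
          (ENNReal.measurable_ofReal.comp (measurable_snd (α := ℝ≥0∞) (β := ℝ)))
        simpa only [ne_eq, h, not_false_eq_true, and_true, Function.comp_apply] using this
    · have hc := (π.continuous_intervalIntegral_exitRate i).measurable
      have he : (fun p : ℝ≥0∞ × ℝ => ∫ u in p.1.toReal..p.2, π.exitRate u i) = fun p =>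
          (∫ u in (0 : ℝ)..p.2, π.exitRate u i) - ∫ u in (0 : ℝ)..p.1.toReal, π.exitRate u i :=
        funext fun p => π.intervalIntegral_exitRate i _ _
      have hm : Measurable fun p : ℝ≥0∞ × ℝ => ∫ u in p.1.toReal..p.2, π.exitRate u i := by
        rw [he]
        exact (hc.comp measurable_snd).sub
          (hc.comp (ENNReal.measurable_toReal.comp measurable_fst))
      exact ENNReal.measurable_ofReal.comp (((π.measurable_rate i j).comp measurable_snd).mul
        (Real.measurable_exp.comp hm.neg))
  have h2 : Measurable fun q : (ℝ≥0∞ × ℝ) × (S × S) =>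
      π.jumpDensity (q.1.1, q.2.1) (q.1.2, q.2.2) :=
    measurable_from_prod_countable_left fun ij => key ij.1 ij.2
  have h3 : Measurable fun p : (ℝ≥0∞ × S) × (ℝ × S) =>
      (((p.1.1, p.2.1), (p.1.2, p.2.2)) : (ℝ≥0∞ × ℝ) × (S × S)) := by fun_prop
  exact h2.comp h3

/-- The survival function `exp (-∫_s^t λ)` decreases from one at the rate `λ exp (-∫_s^t λ)`. -/
lemma lintegral_exitRate_le_one (π : M.Policy) (i : S) (s : ℝ) :
    ∫⁻ t in Set.Ioi s, ENNReal.ofReal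
      (π.exitRate t i * Real.exp (-∫ u in s..t, π.exitRate u i)) ≤ 1 := by
  set L : ℝ → ℝ := fun t => ∫ u in s..t, π.exitRate u i with hL
  have hLc : Continuous L :=
    intervalIntegral.continuous_primitive (fun a b => π.intervalIntegrable_exitRate i a b) s
  set g : ℝ → ℝ := fun t => π.exitRate t i * Real.exp (-L t) with hg
  have hg0 : ∀ t, 0 ≤ g t := fun t => mul_nonneg (π.exitRate_nonneg t i) (Real.exp_nonneg _)
  have hgi : ∀ b, IntervalIntegrable g volume s b := fun b =>
    (π.intervalIntegrable_exitRate i s b).mul_continuousOn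
      (Real.continuous_exp.comp hLc.neg).continuousOn
  have hLmono : ∀ t, s ≤ t → 0 ≤ L t := fun t ht =>
    intervalIntegral.integral_nonneg ht fun u _ => π.exitRate_nonneg u i
  have hint : ∀ b, s ≤ b → ∫ t in s..b, g t = 1 - Real.exp (-L b) := by
    intro b hb
    have hLac : AbsolutelyContinuousOnInterval L s b :=
      (π.intervalIntegrable_exitRate i s b).absolutelyContinuousOnInterval_intervalIntegral
        (by simp)
    have hFac : AbsolutelyContinuousOnInterval (fun t => Real.exp (-L t)) s b := by
      have hlip : LipschitzOnWith 1 (fun y : ℝ => Real.exp (-y)) (Set.Ici 0) := by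
        refine (convex_Ici (0 : ℝ)).lipschitzOnWith_of_nnnorm_hasDerivWithin_le
          (f' := fun y => Real.exp (-y) * (-1)) (fun y _ => ?_) (fun y hy => ?_)
        · exact ((hasDerivAt_id y).neg.exp).hasDerivWithinAt
        · rw [← NNReal.coe_le_coe]
          simpa using hy
      rw [absolutelyContinuousOnInterval_iff] at hLac ⊢
      intro ε hε
      obtain ⟨δ, hδ, h⟩ := hLac ε hε
      refine ⟨δ, hδ, fun E hE hE' => lt_of_le_of_lt (Finset.sum_le_sum fun k hk => ?_) (h E hE hE')⟩
      have hm := hE.1 k hk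
      rw [Set.uIcc_of_le hb] at hm
      simpa using hlip.dist_le_mul (L (E.2 k).1) (hLmono _ hm.1.1) (L (E.2 k).2) (hLmono _ hm.2.1)
    have hd := hFac.integral_deriv_eq_sub
    have : ∫ t in s..b, deriv (fun t => Real.exp (-L t)) t = ∫ t in s..b, -g t := by
      refine intervalIntegral.integral_congr_ae ?_
      filter_upwards [(π.intervalIntegrable_exitRate i s b).ae_hasDerivAt_integral] with t ht htm
      have h1 := ht (Set.uIoc_subset_uIcc htm) s (by simp)
      have h2 : HasDerivAt (fun t => Real.exp (-L t)) (Real.exp (-L t) * -π.exitRate t i) t :=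
        h1.neg.exp
      rw [h2.deriv]
      simp only [hg]; ring
    rw [this, intervalIntegral.integral_neg] at hd
    have h0 : L s = 0 := by simp [hL]
    rw [h0] at hd
    simp at hd
    linarith
  have hle : ∀ n : ℕ, ∫⁻ t in Set.Ioc s (s + n), ENNReal.ofReal (g t) ≤ 1 := by
    intro n
    have hn : s ≤ s + n := by simp
    rw [← ofReal_integral_eq_lintegral_ofReal ((intervalIntegrable_iff_integrableOn_Ioc_of_le hn).1
      (hgi _)) (ae_of_all _ hg0), ← intervalIntegral.integral_of_le hn, hint _ hn]
    exact ENNReal.ofReal_le_one.2 (by linarith [Real.exp_nonneg (-L (s + n))])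
  have hU : Set.Ioi s = ⋃ n : ℕ, Set.Ioc s (s + n) := by
    ext t
    simp only [Set.mem_Ioi, Set.mem_iUnion, Set.mem_Ioc, exists_and_left]
    refine ⟨fun h => ⟨h, ?_⟩, fun h => h.1⟩
    obtain ⟨n, hn⟩ := exists_nat_ge (t - s)
    exact ⟨n, by linarith⟩
  have hmono : Monotone fun n : ℕ => Set.Ioc s (s + n) := fun m n hmn =>
    Set.Ioc_subset_Ioc_right (by gcongr)
  rw [hU, setLIntegral_iUnion_of_directed _ hmono.directed_le]
  exact iSup_le hle

lemma lintegral_jumpDensity_le_one [Countable S] [MeasurableSpace S] [MeasurableSingletonClass S]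
    (π : M.Policy) (x : ℝ≥0∞ × S) :
    ∫⁻ y, π.jumpDensity x y ∂((volume : Measure ℝ).prod Measure.count) ≤ 1 := by
  classical
  obtain ⟨s, i⟩ := x
  have hm : Measurable (π.jumpDensity (s, i)) := π.measurable_jumpDensity.of_uncurry_left
  rw [lintegral_prod _ hm.aemeasurable]
  refine le_trans ?_ (π.lintegral_exitRate_le_one i s.toReal)
  rw [← lintegral_indicator measurableSet_Ioi]
  refine lintegral_mono fun t => ?_
  rw [lintegral_count]
  by_cases ht : s < ENNReal.ofReal t
  · have hts : s.toReal < t := (ENNReal.lt_ofReal_iff_toReal_lt (ne_top_of_lt ht)).1 ht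
    rw [Set.indicator_of_mem (Set.mem_Ioi.2 hts), ENNReal.ofReal_mul (π.exitRate_nonneg t i),
      ← π.tsum_rate t i, ← ENNReal.tsum_mul_right]
    refine ENNReal.tsum_le_tsum fun j => ?_
    by_cases hj : j = i
    · simp [jumpDensity, hj]
    · simp only [jumpDensity, ht, hj, ne_eq, not_false_eq_true, and_self, if_true]
      rw [ENNReal.ofReal_mul (π.rate_nonneg t hj)]
  · simp [jumpDensity, ht]

/-- The law of the next jump `(time, state)`, given that the state `x.2` was entered at time `x.1`.
The mass missing from the density is the probability that no further jump occurs; this is recorded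
as a jump time `∞`. -/
noncomputable def jumpMeasure [MeasurableSpace S] (π : M.Policy) (x : ℝ≥0∞ × S) :
    Measure (ℝ≥0∞ × S) :=
  (((volume : Measure ℝ).prod Measure.count).withDensity (π.jumpDensity x)).map
      (fun y => (ENNReal.ofReal y.1, y.2))
    + (1 - ∫⁻ y, π.jumpDensity x y ∂((volume : Measure ℝ).prod Measure.count)) •
      Measure.dirac (∞, x.2)

section PathLaw

variable [Countable S] [MeasurableSpace S] [MeasurableSingletonClass S]

/-- `jumpMeasure` as a transition kernel of the space-time chain of successive jumps. -/
noncomputable def jumpKernel (π : M.Policy) : Kernel (ℝ≥0∞ × S) (ℝ≥0∞ × S) where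
  toFun := π.jumpMeasure
  measurable' := by
    have hd := π.measurable_jumpDensity
    refine Measure.measurable_of_measurable_coe _ fun B hB => ?_
    have hφ : Measurable fun y : ℝ × S => (ENNReal.ofReal y.1, y.2) := by fun_prop
    have h1 : ∀ x, π.jumpMeasure x B
        = (∫⁻ y in (fun y : ℝ × S => (ENNReal.ofReal y.1, y.2)) ⁻¹' B, π.jumpDensity x y
            ∂((volume : Measure ℝ).prod Measure.count))
          + (1 - ∫⁻ y, π.jumpDensity x y ∂((volume : Measure ℝ).prod Measure.count)) *
            B.indicator 1 ((∞, x.2) : ℝ≥0∞ × S) := fun x => by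
      rw [jumpMeasure, Measure.add_apply, Measure.map_apply hφ hB,
        withDensity_apply _ (hφ hB), Measure.smul_apply, Measure.dirac_apply' _ hB, smul_eq_mul]
    simp_rw [h1]
    refine (hd.lintegral_prod_right').add ((measurable_const.sub hd.lintegral_prod_right').mul ?_)
    exact (measurable_one.indicator hB).comp (by fun_prop)

instance isMarkovKernel_jumpKernel (π : M.Policy) : IsMarkovKernel π.jumpKernel where
  isProbabilityMeasure x := by
    have hφ : Measurable fun y : ℝ × S => (ENNReal.ofReal y.1, y.2) := by fun_prop
    refine ⟨?_⟩
    change π.jumpMeasure x Set.univ = 1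
    rw [jumpMeasure, Measure.add_apply, Measure.map_apply hφ MeasurableSet.univ, Set.preimage_univ,
      withDensity_apply _ MeasurableSet.univ, Measure.smul_apply, measure_univ, smul_eq_mul,
      mul_one, Measure.restrict_univ]
    exact add_tsub_cancel_of_le (π.lintegral_jumpDensity_le_one x)

/-- The law of the sequence of jumps `(T_n, Y_n)`, with `(T_0, Y_0) = x`, of the Markov jump
process with the rates `q(j | i, π_t)` which enters the state `x.2` at time `x.1`. -/
noncomputable def jumpLaw (π : M.Policy) (x : ℝ≥0∞ × S) : Measure (ℕ → ℝ≥0∞ × S) :=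
  Kernel.traj (X := fun _ => ℝ≥0∞ × S)
    (fun n => π.jumpKernel.comap (fun h => h ⟨n, Finset.mem_Iic.2 le_rfl⟩)
      (measurable_pi_apply _)) 0 (fun _ => x)

/-- The law of the process that starts in the state `i` at time `0`. -/
noncomputable def law (π : M.Policy) (i : S) : Measure (ℕ → ℝ≥0∞ × S) := π.jumpLaw (0, i)

end PathLaw

end Policy

open Classical in
/-- The state `x(t)` of the jump process with jumps `ω n = (T_n, Y_n)`: it is `Y_n` for
`T_n ≤ t < T_{n+1}`. From the time `sup T_n` on (if infinitely many jumps occur in finite time),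
the process is in no state, `none`. -/
noncomputable def stateAt (ω : ℕ → ℝ≥0∞ × S) (t : ℝ≥0∞) : Option S :=
  if h : ∃ n, (ω n).1 ≤ t ∧ t < (ω (n + 1)).1 then some (ω (Nat.find h)).2 else none

/-- The first passage time to `i₀`: the first time at which at least one transition has occurred
and the process is in the state `i₀` (`∞` if there is no such time). -/
noncomputable def firstPassageTime (i₀ : S) (ω : ℕ → ℝ≥0∞ × S) : ℝ≥0∞ :=
  sInf {t | (ω 1).1 ≤ t ∧ stateAt ω t = some i₀}

namespace Policy

/-- The cost rate `c(x(t), π_t)` at time `t`, which is zero after an explosion. -/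
noncomputable def runningCost (π : M.Policy) (ω : ℕ → ℝ≥0∞ × S) (t : ℝ) : ℝ≥0∞ :=
  (stateAt ω (ENNReal.ofReal t)).elim 0 fun i => ENNReal.ofReal (π.costRate t i)

variable [Countable S] [MeasurableSpace S] [MeasurableSingletonClass S]

/-- The expected time `m_{i,i₀}(π)` of a first passage from `i` to `i₀`. -/
noncomputable def passageTime (π : M.Policy) (i i₀ : S) : ℝ≥0∞ :=
  ∫⁻ ω, firstPassageTime i₀ ω ∂(π.law i)

/-- The expected cost `c_{i,i₀}(π)` of a first passage from `i` to `i₀`. -/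
noncomputable def passageCost (π : M.Policy) (i i₀ : S) : ℝ≥0∞ :=
  ∫⁻ ω, (∫⁻ t in {t : ℝ | 0 ≤ t ∧ ENNReal.ofReal t < firstPassageTime i₀ ω},
    π.runningCost ω t) ∂(π.law i)

/-- The expected discounted cost `J_α(i, π) = ∫_0^∞ e^{-αt} E_i^π[c(x(t), π_t)] dt`. -/
noncomputable def discountedCost (π : M.Policy) (α : ℝ) (i : S) : ℝ≥0∞ :=
  ∫⁻ t in Set.Ici (0 : ℝ),
    ENNReal.ofReal (Real.exp (-α * t)) * (∫⁻ ω, π.runningCost ω t ∂(π.law i))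

end Policy

section Optimal

variable [Countable S] [MeasurableSpace S] [MeasurableSingletonClass S]

/-- The optimal discounted cost `J*_α(i)`, the infimum over all randomized Markov policies. -/
noncomputable def optimalCost (M : CTMDP S A) (α : ℝ) (i : S) : ℝ≥0∞ :=
  ⨅ π : M.Policy, π.discountedCost α i

/-- The relative value `h_α(i) = J*_α(i) - J*_α(i₀)`; it is meaningful when both are finite. -/
noncomputable def relativeValue (M : CTMDP S A) (i₀ : S) (α : ℝ) (i : S) : ℝ :=
  (M.optimalCost α i).toReal - (M.optimalCost α i₀).toReal

/-- The function `H` witnesses the assumption (A2) for the state `i₀` along the discount factors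
`α n`: it is nonnegative, and `h_{α n}` is well defined and bounded above by `H` for all `n`. -/
def AssumptionA2 (M : CTMDP S A) (i₀ : S) (α : ℕ → ℝ) (H : S → ℝ) : Prop :=
  (∀ i, 0 ≤ H i) ∧
    ∀ i n, M.optimalCost (α n) i < ∞ ∧ M.relativeValue i₀ (α n) i ≤ H i

end Optimal

end CTMDP

/-! The obvious argument follows `θ` up to the passage time and then a near-optimal policy restarted
at `i₀`. Such a concatenation depends on whether the passage has already happened, so it is not a
Markov policy and does not directly compete in `optimalCost`. The proof therefore identifies the
optimal cost with `value`, the limit of value iteration for the Bellman operator, and compares `θ`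
with that function instead.

The central estimate is `discount_mul_valueIteration_le`: for any policy, the `n`-th iterate is at
most the discounted cost up to the `n`-th jump or the first entrance into `K`, plus any bound `v`
for `value` on `K`. It is proved by induction over jumps. Conditioning on the next jump writes both
sides as integrals against the same survival function, where the Bellman inequality applies at each
time. Value iteration does not depend on time, so the induction covers arbitrary time-dependent
policies.

The estimate is used twice. With `K = ∅` and `v = 0` it gives `value_le_optimalCost`. With `K =
{i₀}` and `v = value i₀` it gives `value_le_passageCost_add`, because discounting only lowers the
cost of a passage. The reverse bound `optimalCost_le_value` comes from a stationary policy that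
minimises the Bellman quotient in every state: action sets are finite, so `value` is a supersolution
of the Bellman equation, and supersolutions bound the cost of such a policy.

Explosion needs no separate treatment. Costs are sums over sojourns between jumps, hence suprema of
costs up to the `n`-th jump, and these sums count nothing after an explosion. -/

/-! ### Exponential densities with time-dependent rates -/

/-- The fundamental theorem of calculus for the function `exp (-∫_s^t l)`. -/
lemma intervalIntegral_mul_exp_neg_primitive {l : ℝ → ℝ} (hl0 : ∀ t, 0 ≤ l t)
    (hl : ∀ a b, IntervalIntegrable l volume a b) {s b : ℝ} (hb : s ≤ b) :
    ∫ t in s..b, l t * Real.exp (-∫ u in s..t, l u) = 1 - Real.exp (-∫ u in s..b, l u) := by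
  set L : ℝ → ℝ := fun t => ∫ u in s..t, l u with hL
  have hLmono : ∀ t, s ≤ t → 0 ≤ L t := fun t ht =>
    intervalIntegral.integral_nonneg ht fun u _ => hl0 u
  have hLac : AbsolutelyContinuousOnInterval L s b :=
    (hl s b).absolutelyContinuousOnInterval_intervalIntegral (by simp)
  have hFac : AbsolutelyContinuousOnInterval (fun t => Real.exp (-L t)) s b := by
    -- The rate need not be continuous, so the primitive is only differentiable almost everywhere
    -- and absolute continuity is needed. It survives composition with a Lipschitz map; `exp (-y)`
    -- is 1-Lipschitz only on `y ≥ 0`, where `L` takes its values.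
    have hlip : LipschitzOnWith 1 (fun y : ℝ => Real.exp (-y)) (Set.Ici 0) := by
      refine (convex_Ici (0 : ℝ)).lipschitzOnWith_of_nnnorm_hasDerivWithin_le
        (f' := fun y => Real.exp (-y) * (-1)) (fun y _ => ?_) (fun y hy => ?_)
      · exact ((hasDerivAt_id y).neg.exp).hasDerivWithinAt
      · rw [← NNReal.coe_le_coe]
        simpa using hy
    rw [absolutelyContinuousOnInterval_iff] at hLac ⊢
    intro ε hε
    obtain ⟨δ, hδ, h⟩ := hLac ε hε
    refine ⟨δ, hδ, fun E hE hE' => lt_of_le_of_lt (Finset.sum_le_sum fun k hk => ?_) (h E hE hE')⟩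
    have hm := hE.1 k hk
    rw [Set.uIcc_of_le hb] at hm
    simpa using hlip.dist_le_mul (L (E.2 k).1) (hLmono _ hm.1.1) (L (E.2 k).2) (hLmono _ hm.2.1)
  have hd := hFac.integral_deriv_eq_sub
  have : ∫ t in s..b, deriv (fun t => Real.exp (-L t)) t
      = ∫ t in s..b, -(l t * Real.exp (-L t)) := by
    refine intervalIntegral.integral_congr_ae ?_
    filter_upwards [(hl s b).ae_hasDerivAt_integral] with t ht htm
    have h1 := ht (Set.uIoc_subset_uIcc htm) s (by simp)
    have h2 : HasDerivAt (fun t => Real.exp (-L t)) (Real.exp (-L t) * -l t) t := h1.neg.exp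
    rw [h2.deriv]
    ring
  rw [this, intervalIntegral.integral_neg] at hd
  have h0 : L s = 0 := by simp [hL]
  rw [h0] at hd
  simp at hd
  linarith

lemma lintegral_Ioc_mul_exp_neg_primitive {l : ℝ → ℝ} (hl0 : ∀ t, 0 ≤ l t)
    (hl : ∀ a b, IntervalIntegrable l volume a b) {s b : ℝ} (hb : s ≤ b) :
    ∫⁻ t in Set.Ioc s b, ENNReal.ofReal (l t * Real.exp (-∫ u in s..t, l u))
      = ENNReal.ofReal (1 - Real.exp (-∫ u in s..b, l u)) := by
  have hLc : Continuous fun t => ∫ u in s..t, l u := intervalIntegral.continuous_primitive hl s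
  have hgi : IntervalIntegrable (fun t => l t * Real.exp (-∫ u in s..t, l u)) volume s b :=
    (hl s b).mul_continuousOn (Real.continuous_exp.comp hLc.neg).continuousOn
  rw [← intervalIntegral_mul_exp_neg_primitive hl0 hl hb, intervalIntegral.integral_of_le hb,
    ofReal_integral_eq_lintegral_ofReal ((intervalIntegrable_iff_integrableOn_Ioc_of_le hb).1 hgi)
      (ae_of_all _ fun t => mul_nonneg (hl0 t) (Real.exp_nonneg _))]

/-- If the rate `l` is bounded below by a positive constant, the density `l exp (-∫_s^t l)`
has total mass one. -/
lemma lintegral_Ioi_mul_exp_neg_primitive {l : ℝ → ℝ} {α : ℝ} (hα : 0 < α) (hlα : ∀ t, α ≤ l t)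
    (hl : ∀ a b, IntervalIntegrable l volume a b) (s : ℝ) :
    ∫⁻ t in Set.Ioi s, ENNReal.ofReal (l t * Real.exp (-∫ u in s..t, l u)) = 1 := by
  have hl0 : ∀ t, 0 ≤ l t := fun t => hα.le.trans (hlα t)
  have hU : Set.Ioi s = ⋃ n : ℕ, Set.Ioc s (s + n) := by
    ext t
    simp only [Set.mem_Ioi, Set.mem_iUnion, Set.mem_Ioc, exists_and_left]
    refine ⟨fun h => ⟨h, ?_⟩, fun h => h.1⟩
    obtain ⟨n, hn⟩ := exists_nat_ge (t - s)
    exact ⟨n, by linarith⟩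
  have hmono : Monotone fun n : ℕ => Set.Ioc s (s + n) := fun m n hmn =>
    Set.Ioc_subset_Ioc_right (by gcongr)
  rw [hU, setLIntegral_iUnion_of_directed _ hmono.directed_le]
  have h1 : ∀ n : ℕ, ∫⁻ t in Set.Ioc s (s + n),
      ENNReal.ofReal (l t * Real.exp (-∫ u in s..t, l u))
      = ENNReal.ofReal (1 - Real.exp (-∫ u in s..(s + n), l u)) := fun n =>
    lintegral_Ioc_mul_exp_neg_primitive hl0 hl (by simp)
  refine le_antisymm (iSup_le fun n => ?_) ?_
  · rw [h1]
    exact ENNReal.ofReal_le_one.2 (by linarith [Real.exp_nonneg (-∫ u in s..(s + n), l u)])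
  · have h2 : Tendsto (fun n : ℕ => ENNReal.ofReal (1 - Real.exp (-(α * n)))) atTop (𝓝 1) := by
      have h3 : Tendsto (fun n : ℕ => α * (n : ℝ)) atTop atTop :=
        tendsto_natCast_atTop_atTop.const_mul_atTop hα
      have h4 := (Real.tendsto_exp_neg_atTop_nhds_zero.comp h3).const_sub 1
      simpa using ENNReal.tendsto_ofReal h4
    refine le_of_tendsto h2 (Eventually.of_forall fun n => ?_)
    refine le_trans ?_ (le_iSup (fun n : ℕ => ∫⁻ t in Set.Ioc s (s + n),
      ENNReal.ofReal (l t * Real.exp (-∫ u in s..t, l u))) n)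
    rw [h1]
    refine ENNReal.ofReal_le_ofReal (sub_le_sub_left (Real.exp_le_exp.2 (neg_le_neg ?_)) _)
    have := intervalIntegral.integral_mono_on (μ := volume) (a := s) (b := s + n) (f := fun _ => α)
      (g := l) (by simp) intervalIntegrable_const (hl _ _) fun t _ => hlα t
    simpa [mul_comm] using this

/-! ### The law of the next jump -/

namespace CTMDP

variable {S A : Type*} {M : CTMDP S A}

namespace Policy

/-- The survival function: the probability that the state `i`, entered at time `s`, has not been
left by time `t`. -/
noncomputable def survival (π : M.Policy) (s : ℝ) (i : S) (t : ℝ) : ℝ≥0∞ :=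
  ENNReal.ofReal (Real.exp (-∫ u in s..t, π.exitRate u i))

lemma measurable_survival (π : M.Policy) (s : ℝ) (i : S) : Measurable (π.survival s i) := by
  have hc : Continuous fun t => ∫ u in s..t, π.exitRate u i :=
    intervalIntegral.continuous_primitive (fun a b => π.intervalIntegrable_exitRate i a b) s
  unfold survival
  fun_prop

/-- Discounting acts as killing at rate `α`. The total rate of jumping or being killed is at least
`α > 0`, so one of the two happens almost surely, even if the state is never left by a jump. -/
lemma lintegral_discounted_survival (π : M.Policy) {α : ℝ} (hα : 0 < α) (s : ℝ) (i : S) :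
    ∫⁻ t in Set.Ioi s, π.survival s i t * (ENNReal.ofReal (Real.exp (-α * t)) *
      (ENNReal.ofReal α + ENNReal.ofReal (π.exitRate t i)))
      = ENNReal.ofReal (Real.exp (-α * s)) := by
  have h := lintegral_Ioi_mul_exp_neg_primitive (l := fun t => α + π.exitRate t i) hα
    (fun t => le_add_of_nonneg_right (π.exitRate_nonneg t i))
    (fun a b => intervalIntegrable_const.add (π.intervalIntegrable_exitRate i a b)) s
  rw [← mul_one (ENNReal.ofReal (Real.exp (-α * s))), ← h,
    ← lintegral_const_mul' _ _ ENNReal.ofReal_ne_top]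
  refine lintegral_congr fun t => ?_
  have h1 : ∫ u in s..t, (α + π.exitRate u i) = (t - s) * α + ∫ u in s..t, π.exitRate u i := by
    rw [intervalIntegral.integral_add intervalIntegrable_const (π.intervalIntegrable_exitRate i _ _)]
    simp
  rw [h1, survival, ← ENNReal.ofReal_add hα.le (π.exitRate_nonneg t i),
    ← ENNReal.ofReal_mul (Real.exp_nonneg _), ← ENNReal.ofReal_mul (Real.exp_nonneg _),
    ← ENNReal.ofReal_mul (Real.exp_nonneg _)]
  congr 1
  have h2 : Real.exp (-α * s) * Real.exp (-((t - s) * α + ∫ u in s..t, π.exitRate u i))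
      = Real.exp (-∫ u in s..t, π.exitRate u i) * Real.exp (-α * t) := by
    rw [← Real.exp_add, ← Real.exp_add]
    congr 1
    ring
  linear_combination (-(α + π.exitRate t i)) * h2

section Kernel

variable [Countable S] [MeasurableSpace S] [MeasurableSingletonClass S]

lemma jumpKernel_apply (π : M.Policy) (x : ℝ≥0∞ × S) : π.jumpKernel x = π.jumpMeasure x := rfl

lemma lintegral_jumpKernel (π : M.Policy) (x : ℝ≥0∞ × S) {h : ℝ≥0∞ × S → ℝ≥0∞}
    (hh : Measurable h) :
    ∫⁻ y, h y ∂(π.jumpKernel x)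
      = (∫⁻ t, ∑' j, π.jumpDensity x (t, j) * h (ENNReal.ofReal t, j))
        + (1 - ∫⁻ y, π.jumpDensity x y ∂((volume : Measure ℝ).prod Measure.count)) *
          h (∞, x.2) := by
  have hm : Measurable (π.jumpDensity x) := π.measurable_jumpDensity.of_uncurry_left
  have hφ : Measurable fun y : ℝ × S => (ENNReal.ofReal y.1, y.2) := by fun_prop
  have hhφ : Measurable fun y : ℝ × S => h (ENNReal.ofReal y.1, y.2) := hh.comp hφ
  rw [jumpKernel_apply, jumpMeasure, lintegral_add_measure, lintegral_map hh hφ,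
    lintegral_withDensity_eq_lintegral_mul _ hm hhφ, lintegral_smul_measure,
    lintegral_dirac' _ hh, lintegral_prod _ (hm.mul hhφ).aemeasurable]
  simp [lintegral_count]

open Classical in
-- The condition `h0` removes the atom at time `∞`; what remains is the density, which splits into
-- survival times transition rate.
lemma lintegral_jumpKernel_of_top (π : M.Policy) {s : ℝ} (hs : 0 ≤ s) (i : S)
    {h : ℝ≥0∞ × S → ℝ≥0∞} (hh : Measurable h) (h0 : h (∞, i) = 0) :
    ∫⁻ y, h y ∂(π.jumpKernel (ENNReal.ofReal s, i))
      = ∫⁻ t in Set.Ioi s, π.survival s i t *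
          ∑' j, (if j ≠ i then ENNReal.ofReal (π.rate t i j) else 0) * h (ENNReal.ofReal t, j) := by
  rw [lintegral_jumpKernel _ _ hh, h0, mul_zero, add_zero, ← lintegral_indicator measurableSet_Ioi]
  refine lintegral_congr fun t => ?_
  by_cases ht : s < t
  · rw [Set.indicator_of_mem (Set.mem_Ioi.2 ht), ← ENNReal.tsum_mul_left]
    refine tsum_congr fun j => ?_
    by_cases hj : j = i
    · simp [jumpDensity, hj]
    · have h1 : ENNReal.ofReal s < ENNReal.ofReal t :=
        (ENNReal.ofReal_lt_ofReal_iff_of_nonneg hs).2 ht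
      simp only [jumpDensity, h1, hj, ne_eq, not_false_eq_true, and_self, if_true,
        ENNReal.toReal_ofReal hs, survival]
      rw [ENNReal.ofReal_mul (π.rate_nonneg t hj)]
      ring
  · rw [Set.indicator_of_notMem (by simpa using ht)]
    have h1 : ¬ ENNReal.ofReal s < ENNReal.ofReal t := by
      rwa [ENNReal.ofReal_lt_ofReal_iff_of_nonneg hs]
    simp [jumpDensity, h1]

lemma jumpKernel_top (π : M.Policy) (i : S) : π.jumpKernel (∞, i) = Measure.dirac (∞, i) := by
  have h : π.jumpDensity (∞, i) = 0 := by
    funext y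
    simp [jumpDensity]
  rw [jumpKernel_apply, jumpMeasure, h]
  simp

/-- The probability that the next jump occurs after time `t`. -/
lemma jumpKernel_Ioi (π : M.Policy) {s t : ℝ} (hs : 0 ≤ s) (hst : s ≤ t) (i : S) :
    π.jumpKernel (ENNReal.ofReal s, i) {y | ENNReal.ofReal t < y.1} = π.survival s i t := by
  classical
  have hB : MeasurableSet {y : ℝ≥0∞ × S | y.1 ≤ ENNReal.ofReal t} :=
    measurableSet_le measurable_fst measurable_const
  have hc : {y : ℝ≥0∞ × S | ENNReal.ofReal t < y.1} = {y | y.1 ≤ ENNReal.ofReal t}ᶜ := by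
    ext y
    simp
  -- The complementary event does not contain the atom at `∞`, so its probability is an integral of
  -- the density alone.
  have h1 : π.jumpKernel (ENNReal.ofReal s, i) {y | y.1 ≤ ENNReal.ofReal t}
      = ENNReal.ofReal (1 - Real.exp (-∫ u in s..t, π.exitRate u i)) := by
    rw [← lintegral_indicator_one hB, lintegral_jumpKernel_of_top π hs i
      (measurable_one.indicator hB) (by simp),
      ← lintegral_Ioc_mul_exp_neg_primitive (fun u => π.exitRate_nonneg u i)
        (fun a b => π.intervalIntegrable_exitRate i a b) hst,
      ← lintegral_indicator measurableSet_Ioi, ← lintegral_indicator measurableSet_Ioc]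
    refine lintegral_congr fun u => ?_
    by_cases hu : s < u
    · rw [Set.indicator_of_mem (Set.mem_Ioi.2 hu)]
      by_cases hut : u ≤ t
      · rw [Set.indicator_of_mem (Set.mem_Ioc.2 ⟨hu, hut⟩), ENNReal.ofReal_mul
          (π.exitRate_nonneg u i), ← π.tsum_rate, mul_comm, survival]
        congr 2
        funext j
        have : ENNReal.ofReal u ≤ ENNReal.ofReal t := ENNReal.ofReal_le_ofReal hut
        simp [this]
      · rw [Set.indicator_of_notMem (by simp [hut])]
        have : ¬ ENNReal.ofReal u ≤ ENNReal.ofReal t := by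
          rw [ENNReal.ofReal_le_ofReal_iff (hs.trans hst)]
          exact hut
        simp [this]
    · rw [Set.indicator_of_notMem (by simpa using hu),
        Set.indicator_of_notMem (by simp [hu])]
  rw [hc, prob_compl_eq_one_sub hB, h1, survival, ← ENNReal.ofReal_one,
    ← ENNReal.ofReal_sub _ (sub_nonneg.2 (Real.exp_le_one_iff.2 (neg_nonpos.2
      (intervalIntegral.integral_nonneg hst fun u _ => π.exitRate_nonneg u i))))]
  simp

/-- Jump times do not decrease. -/
lemma ae_jumpKernel_le (π : M.Policy) (x : ℝ≥0∞ × S) : ∀ᵐ y ∂(π.jumpKernel x), x.1 ≤ y.1 := by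
  have hB : MeasurableSet {y : ℝ≥0∞ × S | ¬ x.1 ≤ y.1} :=
    (measurableSet_le measurable_const measurable_fst).compl
  rw [ae_iff, ← lintegral_indicator_one hB, lintegral_jumpKernel _ _ (measurable_one.indicator hB)]
  have h1 : ∀ t j, π.jumpDensity x (t, j) *
      Set.indicator {y : ℝ≥0∞ × S | ¬ x.1 ≤ y.1} 1 (ENNReal.ofReal t, j) = 0 := fun t j => by
    by_cases h : x.1 < ENNReal.ofReal t
    · simp [h.le]
    · simp [jumpDensity, h]
  simp only [h1]
  simp

end Kernel

end Policy

end CTMDP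

/-! ### Decomposition of paths into sojourns -/

namespace CTMDP

variable {S A : Type*} {M : CTMDP S A}

open Classical in
/-- The cost rate `g` at time `t` during the sojourn between the consecutive jumps `x` and `y`,
zero outside this sojourn. -/
noncomputable def sojournRate (g : ℝ → S → ℝ≥0∞) (x y : ℝ≥0∞ × S) (t : ℝ) : ℝ≥0∞ :=
  if x.1 ≤ ENNReal.ofReal t ∧ ENNReal.ofReal t < y.1 then g t x.2 else 0

/-- The cost incurred at rate `g` between the consecutive jumps `x` and `y`. -/
noncomputable def sojournCost (g : ℝ → S → ℝ≥0∞) (x y : ℝ≥0∞ × S) : ℝ≥0∞ :=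
  ∫⁻ t in Set.Ici (0 : ℝ), sojournRate g x y t

/-- The event that none of the states entered by the jumps `1, …, k` is in `K`. -/
def avoids (K : Set S) (k : ℕ) : Set (ℕ → ℝ≥0∞ × S) :=
  {ω | ∀ m, 1 ≤ m → m ≤ k → (ω m).2 ∉ K}

lemma mem_avoids_succ {K : Set S} {k : ℕ} {ω : ℕ → ℝ≥0∞ × S} :
    ω ∈ avoids K (k + 1) ↔ ω ∈ avoids K k ∧ (ω (k + 1)).2 ∉ K := by
  refine ⟨fun h => ⟨fun m h1 h2 => h m h1 (h2.trans k.le_succ), h _ (by simp) le_rfl⟩,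
    fun h m h1 h2 => ?_⟩
  rcases Nat.le_succ_iff.1 h2 with h3 | rfl
  · exact h.1 m h1 h3
  · exact h.2

section Pathwise

variable {ω : ℕ → ℝ≥0∞ × S}

lemma eq_of_mem_sojourn (hω : Monotone fun n => (ω n).1) {t : ℝ≥0∞} {k m : ℕ}
    (hk : (ω k).1 ≤ t ∧ t < (ω (k + 1)).1) (hm : (ω m).1 ≤ t ∧ t < (ω (m + 1)).1) : k = m := by
  by_contra hne
  rcases lt_or_gt_of_ne hne with h | h
  · exact absurd (hk.2.trans_le (hω (Nat.succ_le_of_lt h))) (not_lt.2 hm.1)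
  · exact absurd (hm.2.trans_le (hω (Nat.succ_le_of_lt h))) (not_lt.2 hk.1)

lemma stateAt_eq_some (hω : Monotone fun n => (ω n).1) {t : ℝ≥0∞} {k : ℕ}
    (hk : (ω k).1 ≤ t ∧ t < (ω (k + 1)).1) : stateAt ω t = some (ω k).2 := by
  classical
  have h : ∃ n, (ω n).1 ≤ t ∧ t < (ω (n + 1)).1 := ⟨k, hk⟩
  rw [stateAt, dif_pos h, eq_of_mem_sojourn hω hk (Nat.find_spec h)]

lemma stateAt_eq_none {t : ℝ≥0∞} (h : ¬ ∃ n, (ω n).1 ≤ t ∧ t < (ω (n + 1)).1) :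
    stateAt ω t = none := by
  rw [stateAt, dif_neg h]

/-- A time counted in the passage time is at least `T_1`, so its sojourn has index at least one,
even when the path starts in `i₀`. Avoidance then forces the index beyond `k`. -/
lemma le_firstPassageTime (hω : Monotone fun n => (ω n).1) {i₀ : S} {k : ℕ}
    (hk : ω ∈ avoids {i₀} k) : (ω (k + 1)).1 ≤ firstPassageTime i₀ ω := by
  refine le_sInf fun t ht => ?_
  by_cases h : ∃ n, (ω n).1 ≤ t ∧ t < (ω (n + 1)).1
  · obtain ⟨m, hm⟩ := h
    have h1 := ht.2
    rw [stateAt_eq_some hω hm, Option.some_inj] at h1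
    have hm1 : 1 ≤ m := by
      by_contra h0
      obtain rfl : m = 0 := by omega
      exact absurd hm.2 (not_lt.2 ht.1)
    have hkm : k + 1 ≤ m := by
      by_contra hlt
      exact hk m hm1 (by omega) h1
    exact (hω hkm).trans hm.1
  · exact absurd ht.2 (by simp [stateAt_eq_none h])

/-- Along a path with nondecreasing jump times, a function of the state that is zero after an
explosion is the sum of its values during the sojourns. -/
lemma tsum_sojournRate (hω : Monotone fun n => (ω n).1) (g : ℝ → S → ℝ≥0∞) (t : ℝ) :
    ∑' k, sojournRate g (ω k) (ω (k + 1)) t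
      = (stateAt ω (ENNReal.ofReal t)).elim 0 (g t) := by
  by_cases h : ∃ n, (ω n).1 ≤ ENNReal.ofReal t ∧ ENNReal.ofReal t < (ω (n + 1)).1
  · obtain ⟨k, hk⟩ := h
    rw [stateAt_eq_some hω hk, tsum_eq_single k]
    · simp [sojournRate, hk]
    · intro m hm
      rw [sojournRate, if_neg]
      exact fun h => hm (eq_of_mem_sojourn hω h hk)
  · rw [stateAt_eq_none h]
    rw [not_exists] at h
    simp [sojournRate, h]

end Pathwise

section Measurability

variable [MeasurableSpace S]

lemma measurable_sojournRate {g : ℝ → S → ℝ≥0∞} (hg : Measurable fun p : ℝ × S => g p.1 p.2) :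
    Measurable fun p : ((ℝ≥0∞ × S) × (ℝ≥0∞ × S)) × ℝ => sojournRate g p.1.1 p.1.2 p.2 := by
  classical
  unfold sojournRate
  have h1 : Measurable fun p : ((ℝ≥0∞ × S) × (ℝ≥0∞ × S)) × ℝ => p.1.1.1 := by fun_prop
  have h2 : Measurable fun p : ((ℝ≥0∞ × S) × (ℝ≥0∞ × S)) × ℝ => p.1.2.1 := by fun_prop
  have h3 : Measurable fun p : ((ℝ≥0∞ × S) × (ℝ≥0∞ × S)) × ℝ => ENNReal.ofReal p.2 := by fun_prop
  have h4 : Measurable fun p : ((ℝ≥0∞ × S) × (ℝ≥0∞ × S)) × ℝ => (p.2, p.1.1.2) := by fun_prop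
  exact Measurable.ite ((measurableSet_le h1 h3).inter (measurableSet_lt h3 h2)) (hg.comp h4)
    measurable_const

lemma measurable_sojournCost {g : ℝ → S → ℝ≥0∞} (hg : Measurable fun p : ℝ × S => g p.1 p.2) :
    Measurable fun p : (ℝ≥0∞ × S) × (ℝ≥0∞ × S) => sojournCost g p.1 p.2 :=
  (measurable_sojournRate hg).lintegral_prod_right'

lemma measurable_sojournRate_right {g : ℝ → S → ℝ≥0∞}
    (hg : Measurable fun p : ℝ × S => g p.1 p.2) (x y : ℝ≥0∞ × S) :
    Measurable (sojournRate g x y) :=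
  (measurable_sojournRate hg).comp (measurable_prodMk_left (x := (x, y)))

lemma measurable_sojournCost_path {g : ℝ → S → ℝ≥0∞}
    (hg : Measurable fun p : ℝ × S => g p.1 p.2) (k : ℕ) :
    Measurable fun ω : ℕ → ℝ≥0∞ × S => sojournCost g (ω k) (ω (k + 1)) :=
  (measurable_sojournCost hg).comp
    (by fun_prop : Measurable fun ω : ℕ → ℝ≥0∞ × S => (ω k, ω (k + 1)))

variable [Countable S] [MeasurableSingletonClass S]

lemma measurableSet_snd_notMem (K : Set S) : MeasurableSet {y : ℝ≥0∞ × S | y.2 ∉ K} :=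
  measurable_snd (Set.to_countable Kᶜ).measurableSet

lemma measurableSet_avoids (K : Set S) (k : ℕ) : MeasurableSet (avoids K k) := by
  have : avoids K k = ⋂ m, ⋂ (_ : 1 ≤ m), ⋂ (_ : m ≤ k),
      (fun ω : ℕ → ℝ≥0∞ × S => ω m) ⁻¹' {y | y.2 ∉ K} := by
    ext ω
    simp [avoids]
  rw [this]
  exact MeasurableSet.iInter fun m => MeasurableSet.iInter fun _ => MeasurableSet.iInter fun _ =>
    measurable_pi_apply m (measurableSet_snd_notMem K)

end Measurability

/-! ### Markov property and costs truncated at the `n`-th jump -/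

namespace Policy

variable [Countable S] [MeasurableSpace S] [MeasurableSingletonClass S]

instance isProbabilityMeasure_jumpLaw (π : M.Policy) (x : ℝ≥0∞ × S) :
    IsProbabilityMeasure (π.jumpLaw x) := by
  unfold jumpLaw
  infer_instance

lemma map_zero_jumpLaw (π : M.Policy) (x : ℝ≥0∞ × S) :
    (π.jumpLaw x).map (fun ω => ω 0) = Measure.dirac x := by
  have hf : (fun ω : ℕ → ℝ≥0∞ × S => ω 0) =
      (fun h : (Π i : Finset.Iic 0, ℝ≥0∞ × S) => h ⟨0, Finset.mem_Iic.2 le_rfl⟩) ∘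
        Preorder.frestrictLe (π := fun _ => ℝ≥0∞ × S) 0 := rfl
  rw [jumpLaw, hf, ← Measure.map_map (by fun_prop) (by fun_prop),
    Kernel.traj_map_frestrictLe_apply, Kernel.partialTraj_self, Kernel.id_apply,
    Measure.map_dirac' (by fun_prop)]

/-- The Markov property of the chain of jumps at step `k`, on an event determined by the
first `k` jumps. -/
lemma setLIntegral_jumpLaw_succ (π : M.Policy) (x : ℝ≥0∞ × S) (k : ℕ)
    {B : Set (Π _ : Finset.Iic k, ℝ≥0∞ × S)} (hB : MeasurableSet B)
    {F : ℝ≥0∞ × S → ℝ≥0∞ × S → ℝ≥0∞} (hF : Measurable fun p : _ × _ => F p.1 p.2) :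
    ∫⁻ ω in {ω | Preorder.frestrictLe k ω ∈ B}, F (ω k) (ω (k + 1)) ∂(π.jumpLaw x)
      = ∫⁻ ω in {ω | Preorder.frestrictLe k ω ∈ B}, ∫⁻ y, F (ω k) y ∂(π.jumpKernel (ω k))
          ∂(π.jumpLaw x) := by
  classical
  set κ : (n : ℕ) → Kernel (Π _ : Finset.Iic n, ℝ≥0∞ × S) (ℝ≥0∞ × S) := fun n =>
    π.jumpKernel.comap (fun h => h ⟨n, Finset.mem_Iic.2 le_rfl⟩) (measurable_pi_apply _) with hκ
  have hlaw : π.jumpLaw x = Kernel.traj (X := fun _ => ℝ≥0∞ × S) κ 0 (fun _ => x) := rfl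
  have hB' : MeasurableSet {ω : ℕ → ℝ≥0∞ × S | Preorder.frestrictLe k ω ∈ B} :=
    Preorder.measurable_frestrictLe (X := fun _ => ℝ≥0∞ × S) k hB
  set Φ : (Π _ : Finset.Iic k, ℝ≥0∞ × S) × (ℝ≥0∞ × S) → ℝ≥0∞ := fun p =>
    B.indicator 1 p.1 * F (p.1 ⟨k, Finset.mem_Iic.2 le_rfl⟩) p.2 with hΦdef
  have hΦ : Measurable Φ := by
    refine ((measurable_one.indicator hB).comp measurable_fst).mul ?_
    exact hF.comp (by fun_prop : Measurable fun p : (Π _ : Finset.Iic k, ℝ≥0∞ × S) × (ℝ≥0∞ × S) =>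
      (p.1 ⟨k, Finset.mem_Iic.2 le_rfl⟩, p.2))
  -- The joint law of the first jumps and the next one is the law of the former composed with the
  -- jump kernel.
  have h1 := Kernel.partialTraj_compProd_eq_map_traj (X := fun _ => ℝ≥0∞ × S) (κ := κ)
    (Nat.zero_le k) (x₀ := fun _ => x)
  have h2 : ∫⁻ p, Φ p ∂((Kernel.traj (X := fun _ => ℝ≥0∞ × S) κ 0 (fun _ => x)).map
      (fun ω => (Preorder.frestrictLe k ω, ω (k + 1))))
      = ∫⁻ h, ∫⁻ y, Φ (h, y) ∂(κ k h)
        ∂((Kernel.traj (X := fun _ => ℝ≥0∞ × S) κ 0 (fun _ => x)).map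
          (Preorder.frestrictLe k)) := by
    rw [← h1, Measure.lintegral_compProd hΦ, Kernel.traj_map_frestrictLe_apply]
  rw [lintegral_map hΦ (by fun_prop), lintegral_map hΦ.lintegral_kernel_prod_right'
    (by fun_prop)] at h2
  rw [hlaw, ← lintegral_indicator hB', ← lintegral_indicator hB']
  convert h2 using 2
  · funext ω
    by_cases h : Preorder.frestrictLe k ω ∈ B
    · rw [Set.indicator_of_mem (by exact h)]
      simp [hΦdef, h]
    · rw [Set.indicator_of_notMem (by exact h)]
      simp [hΦdef, h]
  · funext ω
    by_cases h : Preorder.frestrictLe k ω ∈ B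
    · rw [Set.indicator_of_mem (by exact h)]
      simp [hΦdef, h, hκ, Kernel.comap_apply]
    · rw [Set.indicator_of_notMem (by exact h)]
      simp [hΦdef, h]

lemma setLIntegral_avoids_succ (π : M.Policy) (x : ℝ≥0∞ × S) (K : Set S) (k : ℕ)
    {F : ℝ≥0∞ × S → ℝ≥0∞ × S → ℝ≥0∞} (hF : Measurable fun p : _ × _ => F p.1 p.2) :
    ∫⁻ ω in avoids K k, F (ω k) (ω (k + 1)) ∂(π.jumpLaw x)
      = ∫⁻ ω in avoids K k, ∫⁻ y, F (ω k) y ∂(π.jumpKernel (ω k)) ∂(π.jumpLaw x) := by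
  have hB : MeasurableSet {h : Π _ : Finset.Iic k, ℝ≥0∞ × S | ∀ m, 1 ≤ m.1 → (h m).2 ∉ K} := by
    have : {h : Π _ : Finset.Iic k, ℝ≥0∞ × S | ∀ m, 1 ≤ m.1 → (h m).2 ∉ K}
        = ⋂ m, ⋂ (_ : 1 ≤ m.1), (fun h => h m) ⁻¹' {y | y.2 ∉ K} := by
      ext h
      simp
    rw [this]
    exact MeasurableSet.iInter fun m => MeasurableSet.iInter fun _ =>
      measurable_pi_apply m (measurableSet_snd_notMem K)
  have hA : avoids K k = {ω : ℕ → ℝ≥0∞ × S | Preorder.frestrictLe k ω ∈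
      {h : Π _ : Finset.Iic k, ℝ≥0∞ × S | ∀ m, 1 ≤ m.1 → (h m).2 ∉ K}} := by
    ext ω
    refine ⟨fun h m hm => h m.1 hm (Finset.mem_Iic.1 m.2), fun h m h1 h2 => ?_⟩
    exact h ⟨m, Finset.mem_Iic.2 h2⟩ h1
  rw [hA]
  exact π.setLIntegral_jumpLaw_succ x k hB hF

/-- Jump times do not decrease along almost every path. -/
lemma ae_monotone_jumpLaw (π : M.Policy) (x : ℝ≥0∞ × S) :
    ∀ᵐ ω ∂(π.jumpLaw x), Monotone fun n => (ω n).1 := by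
  have h : ∀ n, ∀ᵐ ω ∂(π.jumpLaw x), (ω n).1 ≤ (ω (n + 1)).1 := fun n => by
    have hC : MeasurableSet {p : (ℝ≥0∞ × S) × (ℝ≥0∞ × S) | ¬ p.1.1 ≤ p.2.1} :=
      (measurableSet_le (measurable_fst.comp measurable_fst)
        (measurable_fst.comp measurable_snd)).compl
    -- The Markov property is applied to the indicator of a decrease, whose conditional expectation
    -- vanishes.
    have h1 := π.setLIntegral_jumpLaw_succ x n MeasurableSet.univ
      (F := fun a b => Set.indicator {p : (ℝ≥0∞ × S) × (ℝ≥0∞ × S) | ¬ p.1.1 ≤ p.2.1} 1 (a, b))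
      (measurable_one.indicator hC)
    have h2 : ∀ a : ℝ≥0∞ × S, ∫⁻ b, Set.indicator
        {p : (ℝ≥0∞ × S) × (ℝ≥0∞ × S) | ¬ p.1.1 ≤ p.2.1} 1 (a, b) ∂(π.jumpKernel a) = 0 := by
      intro a
      refine lintegral_eq_zero_of_ae_eq_zero ?_
      filter_upwards [π.ae_jumpKernel_le a] with b hb
      simp [hb]
    simp only [Set.mem_univ, Set.ofPred_true, Measure.restrict_univ, h2, lintegral_zero] at h1
    have h3 : Measurable fun ω : ℕ → ℝ≥0∞ × S => (ω n, ω (n + 1)) := by fun_prop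
    have h4 := (lintegral_eq_zero_iff ((measurable_one.indicator hC).comp h3)).1 h1
    filter_upwards [h4] with ω hω
    by_contra hlt
    simp [Set.indicator, hlt] at hω
  filter_upwards [ae_all_iff.2 h] with ω hω
  exact monotone_nat_of_le_succ hω

/-- The expected value of `H` at the next jump, if it does not enter `K`. -/
noncomputable def avoidingStep (π : M.Policy) (K : Set S) (H : ℝ≥0∞ × S → ℝ≥0∞)
    (x : ℝ≥0∞ × S) : ℝ≥0∞ :=
  ∫⁻ y in {y | y.2 ∉ K}, H y ∂(π.jumpKernel x)

lemma measurable_avoidingStep (π : M.Policy) (K : Set S) {H : ℝ≥0∞ × S → ℝ≥0∞}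
    (hH : Measurable H) : Measurable (π.avoidingStep K H) :=
  hH.setLIntegral_kernel (measurableSet_snd_notMem K)

lemma measurable_iterate_avoidingStep (π : M.Policy) (K : Set S) {H : ℝ≥0∞ × S → ℝ≥0∞}
    (hH : Measurable H) (k : ℕ) : Measurable ((π.avoidingStep K)^[k] H) := by
  induction k with
  | zero => exact hH
  | succ k ih =>
    rw [Function.iterate_succ_apply']
    exact π.measurable_avoidingStep K ih

/-- The chain killed on entering `K` has `avoidingStep` as its one-step operator. The induction
peels off the last jump, which replaces `H` by `avoidingStep K H`; hence `H` is generalized. -/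
lemma setLIntegral_avoids (π : M.Policy) (x : ℝ≥0∞ × S) (K : Set S) (k : ℕ)
    {H : ℝ≥0∞ × S → ℝ≥0∞} (hH : Measurable H) :
    ∫⁻ ω in avoids K k, H (ω k) ∂(π.jumpLaw x) = (π.avoidingStep K)^[k] H x := by
  induction k generalizing H with
  | zero =>
    have : avoids K 0 = (Set.univ : Set (ℕ → ℝ≥0∞ × S)) := by
      ext ω
      simp only [avoids, Set.mem_ofPred_eq, Set.mem_univ, iff_true]
      intro m h1 h2
      omega
    rw [this, Measure.restrict_univ, ← lintegral_map (f := H) (g := fun ω : ℕ → ℝ≥0∞ × S => ω 0) hH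
      (by fun_prop), π.map_zero_jumpLaw, lintegral_dirac' _ hH]
    rfl
  | succ k ih =>
    rw [Function.iterate_succ_apply, ← ih (π.measurable_avoidingStep K hH)]
    have hK := measurableSet_snd_notMem K
    have h1 := π.setLIntegral_avoids_succ x K k
      (F := fun _ y => Set.indicator {y : ℝ≥0∞ × S | y.2 ∉ K} H y)
      ((hH.indicator hK).comp measurable_snd)
    simp only [lintegral_indicator hK] at h1
    refine Eq.trans ?_ h1
    rw [← lintegral_indicator (measurableSet_avoids K _),
      ← lintegral_indicator (measurableSet_avoids K _)]
    refine lintegral_congr fun ω => ?_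
    by_cases h : ω ∈ avoids K k <;> by_cases h' : (ω (k + 1)).2 ∈ K <;>
      simp [Set.indicator, mem_avoids_succ, h, h']

/-- The expected cost at rate `g` up to the next jump. -/
noncomputable def jumpCost (π : M.Policy) (g : ℝ → S → ℝ≥0∞) (x : ℝ≥0∞ × S) : ℝ≥0∞ :=
  ∫⁻ y, sojournCost g x y ∂(π.jumpKernel x)

lemma measurable_jumpCost (π : M.Policy) {g : ℝ → S → ℝ≥0∞}
    (hg : Measurable fun p : ℝ × S => g p.1 p.2) : Measurable (π.jumpCost g) :=
  (measurable_sojournCost hg).lintegral_kernel_prod_right'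

/-- The expected cost at rate `g` up to the `n`-th jump or the first entrance into `K`. -/
noncomputable def truncatedCost (π : M.Policy) (g : ℝ → S → ℝ≥0∞) (K : Set S) :
    ℕ → ℝ≥0∞ × S → ℝ≥0∞
  | 0 => fun _ => 0
  | n + 1 => fun x => π.jumpCost g x + π.avoidingStep K (π.truncatedCost g K n) x

lemma truncatedCost_eq_sum (π : M.Policy) {g : ℝ → S → ℝ≥0∞}
    (hg : Measurable fun p : ℝ × S => g p.1 p.2) (K : Set S) (n : ℕ) :
    π.truncatedCost g K n
      = fun x => ∑ k ∈ Finset.range n, (π.avoidingStep K)^[k] (π.jumpCost g) x := by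
  induction n with
  | zero => simp [truncatedCost]
  | succ n ih =>
    funext x
    rw [Finset.sum_range_succ']
    refine Eq.trans (congrArg (π.jumpCost g x + ·) ?_) (add_comm _ _)
    rw [ih]
    refine (lintegral_finsetSum _
      fun k _ => π.measurable_iterate_avoidingStep K (π.measurable_jumpCost hg) k).trans ?_
    refine Finset.sum_congr rfl fun k _ => ?_
    rw [Function.iterate_succ_apply']
    rfl

lemma measurable_truncatedCost (π : M.Policy) {g : ℝ → S → ℝ≥0∞}
    (hg : Measurable fun p : ℝ × S => g p.1 p.2) (K : Set S) (n : ℕ) :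
    Measurable (π.truncatedCost g K n) := by
  rw [π.truncatedCost_eq_sum hg]
  exact Finset.measurable_sum _
    fun k _ => π.measurable_iterate_avoidingStep K (π.measurable_jumpCost hg) k

/-- Links the recursion over the first jump, suited to induction, with the pathwise sum of sojourn
costs. -/
lemma sum_setLIntegral_sojournCost (π : M.Policy) {g : ℝ → S → ℝ≥0∞}
    (hg : Measurable fun p : ℝ × S => g p.1 p.2) (K : Set S) (n : ℕ) (x : ℝ≥0∞ × S) :
    ∑ k ∈ Finset.range n, ∫⁻ ω in avoids K k, sojournCost g (ω k) (ω (k + 1)) ∂(π.jumpLaw x)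
      = π.truncatedCost g K n x := by
  rw [π.truncatedCost_eq_sum hg]
  refine Finset.sum_congr rfl fun k _ => ?_
  rw [π.setLIntegral_avoids_succ x K k (measurable_sojournCost hg),
    ← π.setLIntegral_avoids x K k (π.measurable_jumpCost hg)]
  rfl

end Policy

end CTMDP

/-- A finite infimum of increasing sequences commutes with the supremum. -/
lemma ENNReal.iInf_iSup_le_of_monotone {ι : Type*} [Finite ι] {f : ι → ℕ → ℝ≥0∞}
    (hf : ∀ a, Monotone (f a)) : ⨅ a, ⨆ n, f a n ≤ ⨆ n, ⨅ a, f a n := by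
  refine le_of_forall_lt fun c hc => ?_
  obtain ⟨d, hcd, hd⟩ := exists_between hc
  have h : ∀ a, ∃ n, d < f a n := fun a => lt_iSup_iff.1 (hd.trans_le (iInf_le _ a))
  choose N hN using h
  -- Finiteness supplies one index that serves all `a` at once.
  obtain ⟨m, hm⟩ := Finite.bddAbove_range N
  exact hcd.trans_le ((le_iInf fun a => (hN a).le.trans (hf a (hm ⟨a, rfl⟩))).trans
    (le_iSup (fun n => ⨅ a, f a n) m))

/-! ### Passage and discounted costs in terms of truncated costs -/

namespace CTMDP

variable {S A : Type*} {M : CTMDP S A}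

namespace Policy

/-- The discounted cost rate `e^{-αt} c(i, π_t)`. -/
noncomputable def discountedRate (π : M.Policy) (α t : ℝ) (i : S) : ℝ≥0∞ :=
  ENNReal.ofReal (Real.exp (-α * t)) * ENNReal.ofReal (π.costRate t i)

lemma measurable_costRate (π : M.Policy) (i : S) : Measurable fun t => π.costRate t i :=
  Finset.measurable_sum _ fun a _ => (π.prob_measurable i a).const_mul _

variable [Countable S] [MeasurableSpace S] [MeasurableSingletonClass S]

lemma measurable_discountedRate (π : M.Policy) (α : ℝ) :
    Measurable fun p : ℝ × S => π.discountedRate α p.1 p.2 := by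
  refine measurable_from_prod_countable_left fun i => ?_
  have := (π.measurable_costRate i).ennreal_ofReal
  unfold discountedRate
  exact Measurable.mul (by fun_prop) this

/-- The cost up to the first entrance into `i₀` is at most the cost of a first passage. -/
lemma truncatedCost_le_passageCost (π : M.Policy) {g : ℝ → S → ℝ≥0∞}
    (hg : Measurable fun p : ℝ × S => g p.1 p.2)
    (hgc : ∀ t, 0 ≤ t → ∀ j, g t j ≤ ENNReal.ofReal (π.costRate t j)) (n : ℕ) (i i₀ : S) :
    π.truncatedCost g {i₀} n (0, i) ≤ π.passageCost i i₀ := by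
  classical
  rw [← π.sum_setLIntegral_sojournCost hg]
  simp_rw [← lintegral_indicator (measurableSet_avoids ({i₀} : Set S) _)]
  rw [← lintegral_finsetSum _ fun k _ => (measurable_sojournCost_path hg k).indicator
      (measurableSet_avoids _ _)]
  refine lintegral_mono_ae ?_
  filter_upwards [π.ae_monotone_jumpLaw (0, i)] with ω hω
  simp only [Set.indicator_apply]
  have hτ : MeasurableSet {t : ℝ | 0 ≤ t ∧ ENNReal.ofReal t < firstPassageTime i₀ ω} :=
    measurableSet_Ici.inter (measurableSet_lt ENNReal.measurable_ofReal measurable_const)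
  rw [← Finset.sum_filter, ← lintegral_indicator hτ]
  simp only [sojournCost]
  rw [← lintegral_finsetSum _ fun k _ => measurable_sojournRate_right hg _ _,
    ← lintegral_indicator measurableSet_Ici]
  refine lintegral_mono fun t => ?_
  by_cases ht : 0 ≤ t
  · rw [Set.indicator_of_mem (Set.mem_Ici.2 ht)]
    by_cases htτ : ENNReal.ofReal t < firstPassageTime i₀ ω
    · rw [Set.indicator_of_mem (by exact ⟨ht, htτ⟩)]
      refine (ENNReal.sum_le_tsum _).trans ?_
      rw [tsum_sojournRate hω g t, runningCost]
      cases stateAt ω (ENNReal.ofReal t) with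
      | none => simp
      | some j => exact hgc t ht j
    -- Every sojourn kept by the filter ends no later than the passage time, so nothing is counted
    -- from then on.
    · refine (Finset.sum_eq_zero fun k hk => ?_).le.trans (zero_le)
      rw [sojournRate, if_neg]
      exact fun h => htτ (h.2.trans_le (le_firstPassageTime hω (Finset.mem_filter.1 hk).2))
  · rw [Set.indicator_of_notMem (by simpa using ht)]
    exact zero_le

/-- The discounted cost is the limit of the discounted costs up to the `n`-th jump. -/
lemma discountedCost_eq_iSup (π : M.Policy) (α : ℝ) (i : S) :
    π.discountedCost α i = ⨆ n, π.truncatedCost (π.discountedRate α) ∅ n (0, i) := by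
  have hg := π.measurable_discountedRate α
  have hpath : ∀ k, Measurable fun ω : ℕ → ℝ≥0∞ × S => (ω k, ω (k + 1)) := fun k => by fun_prop
  have hsr : ∀ k, Measurable fun p : ℝ × (ℕ → ℝ≥0∞ × S) =>
      sojournRate (π.discountedRate α) (p.2 k) (p.2 (k + 1)) p.1 := fun k =>
    (measurable_sojournRate hg).comp (((hpath k).comp measurable_snd).prodMk measurable_fst)
  have h1 : π.discountedCost α i = ∫⁻ t in Set.Ici (0 : ℝ), ∫⁻ ω,
      ∑' k, sojournRate (π.discountedRate α) (ω k) (ω (k + 1)) t ∂(π.law i) := by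
    refine lintegral_congr fun t => ?_
    -- For a finite constant this rule requires no measurability of `runningCost`.
    rw [← lintegral_const_mul' _ _ ENNReal.ofReal_ne_top]
    refine lintegral_congr_ae ?_
    filter_upwards [π.ae_monotone_jumpLaw (0, i)] with ω hω
    rw [tsum_sojournRate hω, runningCost]
    cases stateAt ω (ENNReal.ofReal t) <;> simp [discountedRate]
  have : IsProbabilityMeasure (π.law i) := π.isProbabilityMeasure_jumpLaw (0, i)
  rw [h1, lintegral_lintegral_swap (Measurable.tsum hsr).aemeasurable]
  have h2 : ∀ ω : ℕ → ℝ≥0∞ × S, ∫⁻ t in Set.Ici (0 : ℝ),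
      ∑' k, sojournRate (π.discountedRate α) (ω k) (ω (k + 1)) t
      = ∑' k, sojournCost (π.discountedRate α) (ω k) (ω (k + 1)) := fun ω =>
    lintegral_tsum fun k => (measurable_sojournRate_right hg _ _).aemeasurable
  simp_rw [h2]
  rw [lintegral_tsum fun k => (measurable_sojournCost_path hg k).aemeasurable,
    ENNReal.tsum_eq_iSup_nat]
  refine iSup_congr fun n => ?_
  rw [← π.sum_setLIntegral_sojournCost hg]
  refine Finset.sum_congr rfl fun k _ => ?_
  have : avoids (∅ : Set S) k = Set.univ := by
    ext ω
    simp [avoids]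
  rw [this, Measure.restrict_univ]
  rfl

lemma jumpCost_top (π : M.Policy) (g : ℝ → S → ℝ≥0∞) (i : S) : π.jumpCost g (∞, i) = 0 := by
  simp [jumpCost, sojournCost, sojournRate]

/-- By Tonelli, the cost rate at time `t` is weighted with the probability that the next jump comes
after `t`. -/
lemma jumpCost_ofReal (π : M.Policy) {g : ℝ → S → ℝ≥0∞}
    (hg : Measurable fun p : ℝ × S => g p.1 p.2) {s : ℝ} (hs : 0 ≤ s) (i : S) :
    π.jumpCost g (ENNReal.ofReal s, i)
      = ∫⁻ t in Set.Ioi s, π.survival s i t * g t i := by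
  have hm : Measurable fun p : (ℝ≥0∞ × S) × ℝ =>
      sojournRate g (ENNReal.ofReal s, i) p.1 p.2 :=
    (measurable_sojournRate hg).comp ((measurable_prodMk_left.comp measurable_fst).prodMk
      measurable_snd)
  unfold jumpCost sojournCost
  rw [lintegral_lintegral_swap hm.aemeasurable, setLIntegral_congr (Ioi_ae_eq_Ici (a := s)), ← lintegral_indicator measurableSet_Ici,
    ← lintegral_indicator measurableSet_Ici]
  refine lintegral_congr fun t => ?_
  by_cases hst : s ≤ t
  · have hB : MeasurableSet {y : ℝ≥0∞ × S | ENNReal.ofReal t < y.1} :=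
      measurableSet_lt measurable_const measurable_fst
    rw [Set.indicator_of_mem (Set.mem_Ici.2 (hs.trans hst)),
      Set.indicator_of_mem (Set.mem_Ici.2 hst), ← π.jumpKernel_Ioi hs hst i, mul_comm,
      ← setLIntegral_const, ← lintegral_indicator hB]
    refine lintegral_congr fun y => ?_
    simp [sojournRate, Set.indicator_apply, ENNReal.ofReal_le_ofReal hst]
  · rw [Set.indicator_of_notMem (a := t) (s := Set.Ici s) (by simpa using hst)]
    by_cases ht : 0 ≤ t
    · have : ¬ ENNReal.ofReal s ≤ ENNReal.ofReal t := by
        rwa [ENNReal.ofReal_le_ofReal_iff ht]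
      simp [sojournRate, this]
    · rw [Set.indicator_of_notMem (by simpa using ht)]

end Policy

/-! ### Discounting, the Bellman operator and value iteration -/

open Classical in
/-- The discount factor `e^{-αs}`, zero at `s = ∞`. -/
noncomputable def discount (α : ℝ) (s : ℝ≥0∞) : ℝ≥0∞ :=
  if s = ∞ then 0 else ENNReal.ofReal (Real.exp (-α * s.toReal))

@[simp] lemma discount_top (α : ℝ) : discount α ∞ = 0 := by simp [discount]

lemma discount_ofReal (α : ℝ) {s : ℝ} (hs : 0 ≤ s) :
    discount α (ENNReal.ofReal s) = ENNReal.ofReal (Real.exp (-α * s)) := by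
  simp [discount, ENNReal.toReal_ofReal hs]

lemma measurable_discount (α : ℝ) : Measurable (discount α) := by
  unfold discount
  exact Measurable.ite (measurableSet_singleton ∞) measurable_const (by fun_prop)

lemma antitone_discount {α : ℝ} (hα : 0 < α) : Antitone (discount α) := by
  intro s t hst
  by_cases ht : t = ∞
  · simp [ht]
  · have hs : s ≠ ∞ := ne_top_of_le_ne_top ht hst
    rw [discount, if_neg ht, discount, if_neg hs]
    refine ENNReal.ofReal_le_ofReal (Real.exp_le_exp.2 ?_)
    have := ENNReal.toReal_mono ht hst
    nlinarith

section Bellman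

open Classical in
/-- The cost rate plus the rate of transition into the value `V`, for the action `a`. -/
noncomputable def actionGain (M : CTMDP S A) (V : S → ℝ≥0∞) (i : S) (a : A) : ℝ≥0∞ :=
  ENNReal.ofReal (M.cost i a) + ∑' j, (if j ≠ i then ENNReal.ofReal (M.rate i a j) else 0) * V j

/-- The Bellman operator of the discounted problem. -/
noncomputable def bellman (M : CTMDP S A) (α : ℝ) (V : S → ℝ≥0∞) (i : S) : ℝ≥0∞ :=
  ⨅ a : {a // a ∈ M.actions i},
    M.actionGain V i a / (ENNReal.ofReal α + ENNReal.ofReal (-M.rate i a i))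

lemma actionGain_mono {V W : S → ℝ≥0∞} (h : V ≤ W) (i : S) (a : A) :
    M.actionGain V i a ≤ M.actionGain W i a :=
  add_le_add_right (ENNReal.tsum_le_tsum fun j => mul_le_mul_right (h j) _) _

lemma bellman_mono (M : CTMDP S A) (α : ℝ) : Monotone (M.bellman α) := fun _ _ h i =>
  iInf_mono fun _ => ENNReal.div_le_div_right (actionGain_mono h i _) _

/-- Monotone convergence for the sum over target states, via its finite partial sums. -/
lemma actionGain_iSup_le {V : ℕ → S → ℝ≥0∞} (hV : Monotone V) (i : S) (a : A) :
    M.actionGain (fun j => ⨆ n, V n j) i a ≤ ⨆ n, M.actionGain (V n) i a := by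
  classical
  unfold actionGain
  rw [← ENNReal.add_iSup]
  refine add_le_add_right ?_ _
  rw [ENNReal.tsum_eq_iSup_sum]
  refine iSup_le fun F => ?_
  simp_rw [ENNReal.mul_iSup]
  rw [ENNReal.finsetSum_iSup_of_monotone
    (f := fun j n => (if j ≠ i then ENNReal.ofReal (M.rate i a j) else 0) * V n j)
    fun j m n hmn => mul_le_mul_right (hV hmn j) _]
  exact iSup_mono fun n => ENNReal.sum_le_tsum F

/-- The minimal cost of the discounted problem with at most `n` jumps. -/
noncomputable def valueIteration (M : CTMDP S A) (α : ℝ) (n : ℕ) : S → ℝ≥0∞ :=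
  (M.bellman α)^[n] 0

lemma valueIteration_succ (M : CTMDP S A) (α : ℝ) (n : ℕ) :
    M.valueIteration α (n + 1) = M.bellman α (M.valueIteration α n) :=
  Function.iterate_succ_apply' _ _ _

lemma monotone_valueIteration (M : CTMDP S A) (α : ℝ) : Monotone (M.valueIteration α) :=
  (M.bellman_mono α).monotone_iterate_of_le_map (bot_le (a := M.bellman α 0))

/-- The limit of the value iteration. -/
noncomputable def value (M : CTMDP S A) (α : ℝ) (i : S) : ℝ≥0∞ := ⨆ n, M.valueIteration α n i

/-- Each quotient is continuous along increasing sequences, and a minimum over finitely many actions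
commutes with increasing limits. -/
lemma bellman_value_le (M : CTMDP S A) (α : ℝ) : M.bellman α (M.value α) ≤ M.value α := by
  intro i
  have hV := M.monotone_valueIteration α
  have hmono : ∀ a : {a // a ∈ M.actions i}, Monotone fun n =>
      M.actionGain (M.valueIteration α n) i a /
        (ENNReal.ofReal α + ENNReal.ofReal (-M.rate i a i)) := fun a m n hmn =>
    ENNReal.div_le_div_right (actionGain_mono (hV hmn) i a.1) _
  calc M.bellman α (M.value α) i
      ≤ ⨅ a : {a // a ∈ M.actions i}, ⨆ n, M.actionGain (M.valueIteration α n) i a /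
          (ENNReal.ofReal α + ENNReal.ofReal (-M.rate i a i)) := by
        refine iInf_mono fun a => ?_
        refine (ENNReal.div_le_div_right (actionGain_iSup_le hV i a.1) _).trans ?_
        rw [ENNReal.iSup_div]
    _ ≤ ⨆ n, M.valueIteration α (n + 1) i := by
        refine (ENNReal.iInf_iSup_le_of_monotone hmono).trans (iSup_mono fun n => ?_)
        rw [valueIteration_succ]
        exact le_rfl
    _ ≤ M.value α i := iSup_le fun n => le_iSup (fun n => M.valueIteration α n i) (n + 1)

/-- The minimum is attained, and the denominator is nonzero (as `α > 0`) and finite, so it can be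
cleared even when the values are infinite. -/
lemma exists_actionGain_le_bellman (M : CTMDP S A) {α : ℝ} (hα : 0 < α) (V : S → ℝ≥0∞) (i : S) :
    ∃ a ∈ M.actions i, M.actionGain V i a
      ≤ (ENNReal.ofReal α + ENNReal.ofReal (-M.rate i a i)) * M.bellman α V i := by
  have : Nonempty {a // a ∈ M.actions i} := (M.actions_nonempty i).to_subtype
  obtain ⟨a, ha⟩ := exists_eq_ciInf_of_finite (f := fun a : {a // a ∈ M.actions i} =>
    M.actionGain V i a / (ENNReal.ofReal α + ENNReal.ofReal (-M.rate i a i)))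
  refine ⟨a, a.2, ?_⟩
  rw [bellman, ← ha, ENNReal.mul_div_cancel (by simp [hα]) (by simp)]

lemma bellman_mul_le_actionGain (M : CTMDP S A) {α : ℝ} (hα : 0 < α) (V : S → ℝ≥0∞) {i : S}
    {a : A} (ha : a ∈ M.actions i) :
    (ENNReal.ofReal α + ENNReal.ofReal (-M.rate i a i)) * M.bellman α V i
      ≤ M.actionGain V i a := by
  rw [mul_comm, ← ENNReal.le_div_iff_mul_le (by simp [hα]) (by simp)]
  exact iInf_le (fun a : {a // a ∈ M.actions i} => M.actionGain V i a /
    (ENNReal.ofReal α + ENNReal.ofReal (-M.rate i a i))) ⟨a, ha⟩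

lemma exitRate_action_nonneg (M : CTMDP S A) {i : S} {a : A} (ha : a ∈ M.actions i) :
    0 ≤ -M.rate i a i := by
  classical
  have h := (M.rate_hasSum i a ha).update i 0
  simp only [zero_sub, add_zero] at h
  refine h.nonneg fun j => ?_
  by_cases hj : j = i
  · subst hj; simp
  · rw [Function.update_of_ne hj]; exact M.rate_nonneg i a ha j hj

/-! ### Comparison of policies with solutions of Bellman inequalities -/

namespace Policy

open Classical in
/-- The cost rate plus the rate of transition into the value `V`, under a policy. -/
noncomputable def gain (π : M.Policy) (V : S → ℝ≥0∞) (t : ℝ) (i : S) : ℝ≥0∞ :=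
  ENNReal.ofReal (π.costRate t i) +
    ∑' j, (if j ≠ i then ENNReal.ofReal (π.rate t i j) else 0) * V j

lemma sum_ofReal_prob (π : M.Policy) (t : ℝ) (i : S) :
    ∑ a ∈ M.actions i, ENNReal.ofReal (π.prob t i a) = 1 := by
  rw [← ENNReal.ofReal_sum_of_nonneg (π.prob_nonneg t i), π.prob_sum, ENNReal.ofReal_one]

lemma ofReal_sum_mul_prob (π : M.Policy) (t : ℝ) (i : S) {r : A → ℝ}
    (hr : ∀ a ∈ M.actions i, 0 ≤ r a) :
    ENNReal.ofReal (∑ a ∈ M.actions i, r a * π.prob t i a)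
      = ∑ a ∈ M.actions i, ENNReal.ofReal (π.prob t i a) * ENNReal.ofReal (r a) := by
  rw [ENNReal.ofReal_sum_of_nonneg fun a ha => mul_nonneg (hr a ha) (π.prob_nonneg t i a ha)]
  refine Finset.sum_congr rfl fun a ha => ?_
  rw [ENNReal.ofReal_mul (hr a ha), mul_comm]

lemma gain_eq_sum (π : M.Policy) (V : S → ℝ≥0∞) (t : ℝ) (i : S) :
    π.gain V t i = ∑ a ∈ M.actions i, ENNReal.ofReal (π.prob t i a) * M.actionGain V i a := by
  classical
  simp only [actionGain, mul_add, Finset.sum_add_distrib, gain]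
  congr 1
  · exact π.ofReal_sum_mul_prob t i (M.cost_nonneg i)
  · simp_rw [← ENNReal.tsum_mul_left]
    rw [← Summable.tsum_finsetSum fun _ _ => ENNReal.summable]
    refine tsum_congr fun j => ?_
    by_cases hj : j = i
    · simp [hj]
    · simp only [hj, ne_eq, not_false_eq_true, if_true]
      rw [rate, π.ofReal_sum_mul_prob t i fun a ha => M.rate_nonneg i a ha j hj, Finset.sum_mul]
      exact Finset.sum_congr rfl fun a _ => mul_assoc _ _ _

lemma add_exitRate_eq_sum (π : M.Policy) (α : ℝ) (t : ℝ) (i : S) :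
    ENNReal.ofReal α + ENNReal.ofReal (π.exitRate t i)
      = ∑ a ∈ M.actions i, ENNReal.ofReal (π.prob t i a) *
          (ENNReal.ofReal α + ENNReal.ofReal (-M.rate i a i)) := by
  simp only [mul_add, Finset.sum_add_distrib, ← Finset.sum_mul, sum_ofReal_prob, one_mul]
  congr 1
  rw [← π.ofReal_sum_mul_prob t i fun a ha => M.exitRate_action_nonneg ha, exitRate, rate]
  simp

/-- With the denominator cleared, both sides are linear in `π_t(· | i)`, so randomization merely
averages the inequalities for single actions. -/
lemma bellman_mul_le_gain (π : M.Policy) {α : ℝ} (hα : 0 < α) (V : S → ℝ≥0∞) (t : ℝ) (i : S) :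
    (ENNReal.ofReal α + ENNReal.ofReal (π.exitRate t i)) * M.bellman α V i ≤ π.gain V t i := by
  rw [π.add_exitRate_eq_sum, π.gain_eq_sum, Finset.sum_mul]
  refine Finset.sum_le_sum fun a ha => ?_
  rw [mul_assoc]
  exact mul_le_mul_right (M.bellman_mul_le_actionGain hα V ha) _

open Classical in
/-- The deterministic stationary policy that uses the action `f i` in the state `i`. -/
noncomputable def stationary (f : S → A) (hf : ∀ i, f i ∈ M.actions i) : M.Policy where
  prob _ i a := if a = f i then 1 else 0
  prob_measurable _ _ := measurable_const
  prob_nonneg _ i a _ := by split_ifs <;> simp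
  prob_sum _ i := by simp [hf i]

lemma gain_stationary_le {α : ℝ} {V W : S → ℝ≥0∞} {f : S → A} (hf : ∀ i, f i ∈ M.actions i)
    (h : ∀ i, M.actionGain V i (f i)
      ≤ (ENNReal.ofReal α + ENNReal.ofReal (-M.rate i (f i) i)) * W i) (t : ℝ) (i : S) :
    (stationary f hf).gain V t i
      ≤ (ENNReal.ofReal α + ENNReal.ofReal ((stationary f hf).exitRate t i)) * W i := by
  rw [gain_eq_sum, add_exitRate_eq_sum, Finset.sum_mul]
  refine Finset.sum_le_sum fun a _ => ?_
  by_cases ha : a = f i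
  · subst ha
    simpa [stationary] using h i
  · simp [stationary, ha]

/-- Puts a discounted constant into the integral form of `jumpCost_add_lintegral_discount`, so that
the two can be compared integrand by integrand. -/
lemma discount_mul_eq_lintegral (π : M.Policy) {α : ℝ} (hα : 0 < α) {s : ℝ} (hs : 0 ≤ s) (i : S)
    (w : ℝ≥0∞) :
    discount α (ENNReal.ofReal s) * w = ∫⁻ t in Set.Ioi s, π.survival s i t *
      (ENNReal.ofReal (Real.exp (-α * t)) *
        ((ENNReal.ofReal α + ENNReal.ofReal (π.exitRate t i)) * w)) := by
  have hm : Measurable fun t => π.survival s i t * (ENNReal.ofReal (Real.exp (-α * t)) *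
      (ENNReal.ofReal α + ENNReal.ofReal (π.exitRate t i))) := by
    have h1 := π.measurable_survival s i
    have h2 := π.measurable_exitRate i
    fun_prop
  rw [discount_ofReal α hs, ← π.lintegral_discounted_survival hα s i, ← lintegral_mul_const _ hm]
  simp only [mul_assoc]

variable [Countable S] [MeasurableSpace S] [MeasurableSingletonClass S]

lemma measurable_discount_mul (α : ℝ) (V : S → ℝ≥0∞) :
    Measurable fun y : ℝ≥0∞ × S => discount α y.1 * V y.2 :=
  ((measurable_discount α).comp measurable_fst).mul
    ((measurable_of_countable V).comp measurable_snd)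

/-- The discounted cost up to the next jump plus the discounted value `V` after it. -/
lemma jumpCost_add_lintegral_discount (π : M.Policy) (α : ℝ) (V : S → ℝ≥0∞) {s : ℝ} (hs : 0 ≤ s)
    (i : S) :
    π.jumpCost (π.discountedRate α) (ENNReal.ofReal s, i)
        + ∫⁻ y, discount α y.1 * V y.2 ∂(π.jumpKernel (ENNReal.ofReal s, i))
      = ∫⁻ t in Set.Ioi s, π.survival s i t *
          (ENNReal.ofReal (Real.exp (-α * t)) * π.gain V t i) := by
  classical
  have hm : Measurable fun t => π.survival s i t * π.discountedRate α t i :=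
    (π.measurable_survival s i).mul ((π.measurable_discountedRate α).comp measurable_prodMk_right)
  rw [π.jumpCost_ofReal (π.measurable_discountedRate α) hs, π.lintegral_jumpKernel_of_top hs i
    (measurable_discount_mul α V) (by simp),
    ← lintegral_add_left hm]
  refine setLIntegral_congr_fun measurableSet_Ioi fun t ht => ?_
  have ht0 : 0 ≤ t := hs.trans (le_of_lt ht)
  simp only [discount_ofReal α ht0, gain, discountedRate, mul_add]
  congr 2
  rw [← ENNReal.tsum_mul_left]
  exact tsum_congr fun j => by ring

lemma lintegral_discount_le (π : M.Policy) {α : ℝ} (hα : 0 < α) (x : ℝ≥0∞ × S) :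
    ∫⁻ y, discount α y.1 ∂(π.jumpKernel x) ≤ discount α x.1 := by
  calc ∫⁻ y, discount α y.1 ∂(π.jumpKernel x)
      ≤ ∫⁻ _, discount α x.1 ∂(π.jumpKernel x) := by
        refine lintegral_mono_ae ?_
        filter_upwards [π.ae_jumpKernel_le x] with y hy using antitone_discount hα hy
    _ = discount α x.1 := by simp

/-- The value iteration is a lower bound for the cost of any policy up to an entrance into `K`,
plus a bound `v` for the value on `K`. -/
lemma discount_mul_valueIteration_le (π : M.Policy) {α : ℝ} (hα : 0 < α) {K : Set S} {v : ℝ≥0∞}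
    (hv : ∀ j ∈ K, M.value α j ≤ v) (n : ℕ) (s : ℝ≥0∞) (i : S) :
    discount α s * M.valueIteration α n i
      ≤ π.truncatedCost (π.discountedRate α) K n (s, i) + discount α s * v := by
  have hg := π.measurable_discountedRate α
  induction n generalizing s i with
  | zero => simp [valueIteration]
  | succ n ih =>
    by_cases hs : s = ∞
    · simp [hs]
    obtain ⟨s, hs0, rfl⟩ : ∃ r : ℝ, 0 ≤ r ∧ s = ENNReal.ofReal r :=
      ⟨s.toReal, ENNReal.toReal_nonneg, (ENNReal.ofReal_toReal hs).symm⟩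
    have hK := measurableSet_snd_notMem (S := S) K
    have hG := π.measurable_truncatedCost hg K n
    have hd : Measurable fun y : ℝ≥0∞ × S => discount α y.1 :=
      (measurable_discount α).comp measurable_fst
    calc discount α (ENNReal.ofReal s) * M.valueIteration α (n + 1) i
        ≤ π.jumpCost (π.discountedRate α) (ENNReal.ofReal s, i)
          + ∫⁻ y, discount α y.1 * M.valueIteration α n y.2
            ∂(π.jumpKernel (ENNReal.ofReal s, i)) := by
          rw [π.jumpCost_add_lintegral_discount α _ hs0, π.discount_mul_eq_lintegral hα hs0 i,
            valueIteration_succ]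
          refine lintegral_mono fun t => ?_
          exact mul_le_mul_right (mul_le_mul_right (π.bellman_mul_le_gain hα _ t i) _) _
      _ ≤ π.jumpCost (π.discountedRate α) (ENNReal.ofReal s, i)
          + ∫⁻ y, Set.indicator {y | y.2 ∉ K} (π.truncatedCost (π.discountedRate α) K n) y
              + discount α y.1 * v ∂(π.jumpKernel (ENNReal.ofReal s, i)) := by
          refine add_le_add_right (lintegral_mono fun y => ?_) _
          -- On `K` the iterate is bounded by `v` and the process is stopped; elsewhere the
          -- induction hypothesis continues from the jump `y`.
          by_cases hy : y.2 ∈ K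
          · refine le_add_left (mul_le_mul_right (le_trans ?_ (hv _ hy)) _)
            exact le_iSup (fun n => M.valueIteration α n y.2) n
          · rw [Set.indicator_of_mem (by exact hy)]
            exact ih y.1 y.2
      _ ≤ π.truncatedCost (π.discountedRate α) K (n + 1) (ENNReal.ofReal s, i)
          + discount α (ENNReal.ofReal s) * v := by
          rw [lintegral_add_left (hG.indicator hK), lintegral_indicator hK,
            lintegral_mul_const _ hd, ← add_assoc]
          -- The `v` terms from stopping and from continuing have merged into one, whose expected
          -- discount cannot exceed that at time `s`.
          exact add_le_add_right (mul_le_mul_left (π.lintegral_discount_le hα _) _) _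

/-- A policy under which `W` dominates the one-step costs has discounted cost at most `W`. -/
lemma truncatedCost_le_discount_mul (π : M.Policy) {α : ℝ} (hα : 0 < α) {W : S → ℝ≥0∞}
    (hW : ∀ t i, π.gain W t i
      ≤ (ENNReal.ofReal α + ENNReal.ofReal (π.exitRate t i)) * W i) (n : ℕ) (s : ℝ≥0∞) (i : S) :
    π.truncatedCost (π.discountedRate α) ∅ n (s, i) ≤ discount α s * W i := by
  induction n generalizing s i with
  | zero => simp [truncatedCost]
  | succ n ih =>
    have hstep : π.truncatedCost (π.discountedRate α) ∅ (n + 1) (s, i)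
        ≤ π.jumpCost (π.discountedRate α) (s, i)
          + ∫⁻ y, discount α y.1 * W y.2 ∂(π.jumpKernel (s, i)) :=
      add_le_add_right ((setLIntegral_le_lintegral _ _).trans
        (lintegral_mono fun y : ℝ≥0∞ × S => ih y.1 y.2)) _
    refine hstep.trans ?_
    by_cases hs : s = ∞
    · subst hs
      -- At time `∞` the chain stays put and incurs no cost.
      rw [π.jumpCost_top, π.jumpKernel_top, lintegral_dirac' _ (measurable_discount_mul α W), zero_add]
    obtain ⟨s, hs0, rfl⟩ : ∃ r : ℝ, 0 ≤ r ∧ s = ENNReal.ofReal r :=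
      ⟨s.toReal, ENNReal.toReal_nonneg, (ENNReal.ofReal_toReal hs).symm⟩
    rw [π.jumpCost_add_lintegral_discount α _ hs0, π.discount_mul_eq_lintegral hα hs0 i]
    exact lintegral_mono fun t => mul_le_mul_right (mul_le_mul_right (hW t i) _) _

end Policy

end Bellman

/-! ### Identification of the optimal cost and the passage inequality -/

section Optimal

variable [Countable S] [MeasurableSpace S] [MeasurableSingletonClass S]

lemma discount_zero (α : ℝ) : discount α 0 = 1 := by simp [discount]

lemma value_le_optimalCost (M : CTMDP S A) {α : ℝ} (hα : 0 < α) (i : S) :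
    M.value α i ≤ M.optimalCost α i := by
  refine le_iInf fun π => ?_
  rw [π.discountedCost_eq_iSup]
  refine iSup_mono fun n => ?_
  simpa [discount_zero] using
    π.discount_mul_valueIteration_le hα (K := ∅) (v := 0) (by simp) n 0 i

/-- The stationary policy of minimising actions has `value` as a supersolution; all its truncated
costs, hence its discounted cost, stay below `value`. -/
lemma optimalCost_le_value (M : CTMDP S A) {α : ℝ} (hα : 0 < α) (i : S) :
    M.optimalCost α i ≤ M.value α i := by
  choose f hf hfV using M.exists_actionGain_le_bellman hα (M.value α)
  refine (iInf_le _ (Policy.stationary f hf)).trans ?_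
  rw [Policy.discountedCost_eq_iSup]
  refine iSup_le fun n => ?_
  have h := (Policy.stationary f hf).truncatedCost_le_discount_mul hα (W := M.value α)
    (Policy.gain_stationary_le hf fun i =>
      (hfV i).trans (mul_le_mul_right (M.bellman_value_le α i) _)) n 0 i
  simpa [discount_zero] using h

lemma value_le_passageCost_add (M : CTMDP S A) {α : ℝ} (hα : 0 < α) (θ : M.Policy) (i i₀ : S) :
    M.value α i ≤ θ.passageCost i i₀ + M.value α i₀ := by
  refine iSup_le fun n => ?_
  have h := θ.discount_mul_valueIteration_le hα (K := {i₀}) (v := M.value α i₀) (by simp) n 0 i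
  rw [discount_zero, one_mul, one_mul] at h
  refine h.trans (add_le_add_left (θ.truncatedCost_le_passageCost
    (θ.measurable_discountedRate α) (fun t ht j => ?_) n i i₀) _)
  -- The discount factor is at most one at times `t ≥ 0`, so the undiscounted passage cost
  -- dominates.
  refine mul_le_of_le_one_left' (ENNReal.ofReal_le_one.2 (Real.exp_le_one_iff.2 ?_))
  nlinarith

/-- Passing first to `i₀` under `θ` and continuing optimally from there is not better than an
optimal policy. -/
lemma optimalCost_le_passageCost_add (M : CTMDP S A) {α : ℝ} (hα : 0 < α) (θ : M.Policy)
    (i i₀ : S) : M.optimalCost α i ≤ θ.passageCost i i₀ + M.optimalCost α i₀ :=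
  (M.optimalCost_le_value hα i).trans ((M.value_le_passageCost_add hα θ i i₀).trans
    (add_le_add_right (M.value_le_optimalCost hα i₀) _))

lemma optimalCost_lt_top_and_relativeValue_le (M : CTMDP S A) {i₀ : S} {α : ℝ} (hα : 0 < α)
    (h₀ : M.optimalCost α i₀ < ∞) {i : S} {θ : M.Policy} (hθ : θ.passageCost i i₀ < ∞) :
    M.optimalCost α i < ∞ ∧ M.relativeValue i₀ α i ≤ (θ.passageCost i i₀).toReal := by
  have h := M.optimalCost_le_passageCost_add hα θ i i₀
  refine ⟨h.trans_lt (ENNReal.add_lt_top.2 ⟨hθ, h₀⟩), ?_⟩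
  rw [relativeValue, sub_le_iff_le_add, ← ENNReal.toReal_add hθ.ne h₀.ne]
  exact ENNReal.toReal_mono (ENNReal.add_lt_top.2 ⟨hθ, h₀⟩).ne h

end Optimal

end CTMDP

theorem mainTheorem4 {S A : Type*} [Countable S] [MeasurableSpace S] [MeasurableSingletonClass S]
    [Finite A] (M : CTMDP S A) (i₀ : S) :
    (∀ α : ℝ, 0 < α → M.optimalCost α i₀ < ∞ →
      ∀ i, i ≠ i₀ → ∀ θ : M.Policy, θ.passageTime i i₀ < ∞ → θ.passageCost i i₀ < ∞ →
        M.optimalCost α i < ∞ ∧ M.relativeValue i₀ α i ≤ (θ.passageCost i i₀).toReal) ∧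
    (∀ α : ℕ → ℝ, (∀ n, 0 < α n) → Antitone α → Tendsto α atTop (𝓝 0) →
      (∀ n, M.optimalCost (α n) i₀ < ∞) →
      ∀ θ : S → M.Policy,
        (∀ i, i ≠ i₀ → (θ i).passageTime i i₀ < ∞ ∧ (θ i).passageCost i i₀ < ∞) →
        ∀ H : S → ℝ, 0 ≤ H i₀ → (∀ i, i ≠ i₀ → H i = ((θ i).passageCost i i₀).toReal) →
          M.AssumptionA2 i₀ α H) := by
  refine ⟨fun α hα h₀ i _ θ _ hθ => M.optimalCost_lt_top_and_relativeValue_le hα h₀ hθ,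
    fun α hα _ _ h₀ θ hθ H hH₀ hH => ⟨fun i => ?_, fun i n => ?_⟩⟩
  · by_cases hi : i = i₀
    · rwa [hi]
    · rw [hH i hi]
      exact ENNReal.toReal_nonneg
  · by_cases hi : i = i₀
    · subst hi
      exact ⟨h₀ n, by simpa [CTMDP.relativeValue] using hH₀⟩
    · rw [hH i hi]
      exact M.optimalCost_lt_top_and_relativeValue_le (hα n) (h₀ n) (hθ i hi).2
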